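/- Let $X$ be a topological space. A *nesting* $\eta$ on $X$ assigns an open subset $\eta(x_1,\dots,x_n)\subseteq X$ to every finite (possibly empty) sequence of points of $X$, such that: (i) $\eta(\emptyset)=X$; (ii) if $n\ge 1$ and $x_1\in\eta(x_2,\dots,x_n)$, then $x_1\in\eta(x_1,\dots,x_n)$; (iii) $\eta(x_1,\dots,x_n)\subseteq\eta(x_{f(1)},\dots,x_{f(m)})$ for every nondecreasing $f\colon\{1,\dots,m\}\to\{1,\dots,n\}$. For a singular simplex $\sigma\colon\Delta^n\to X$ let $b(\sigma)$ be the image of the barycenter of $\Delta^n$. Let $C_\bullet(X)$ be the singular chain complex of $X$ (with integer coefficients), and let $C_n^\eta(X)\subseteq C_n(X)$ be the free abelian group on those singular simplices $\sigma\colon\Delta^n\to X$ such that, for every $m\ge 1$ and every chain of (nonempty, not necessarily distinct) faces $\sigma_1\subseteq\cdots\subseteq\sigma_m\subseteq\sigma$, the image of $\sigma_1$ is contained in $\eta(b(\sigma_1),\dots,b(\sigma_m))$. These groups form a subcomplex $C_\bullet^\eta(X)$ of $C_\bullet(X)$. For an abelian group $A$ put $C^\bullet(X;A)=\operatorname{Hom}(C_\bullet(X),A)$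 and $C^\bullet_\eta(X;A)=\operatorname{Hom}(C_\bullet^\eta(X),A)$. Theorem. For every topological space $X$ and every nesting $\eta$ on $X$, the inclusion $C_\bullet^\eta(X)\to C_\bullet(X)$ is a chain homotopy equivalence. Consequently, for every abelian group $A$, the dual restriction map $C^\bullet(X;A)\to C^\bullet_\eta(X;A)$ is a (co)chain homotopy equivalence. -/

import Mathlib

open CategoryTheory Opposite
open scoped Simplicial

universe u v

/-- A nesting on a topological space `X`: an open subset `η [x₁, …, xₙ]` of `X` for every finite
(possibly empty) sequence of points of `X`, subject to three conditions. -/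
structure Nesting (X : Type u) [TopologicalSpace X] where
  /-- the open set attached to a finite sequence -/
  toFun : List X → TopologicalSpace.Opens X
  /-- `η(∅) = X` -/
  nil : toFun [] = ⊤
  /-- if `x₁ ∈ η(x₂, …, xₙ)`, then `η(x₁, …, xₙ)` is a neighbourhood of `x₁` -/
  mem_cons : ∀ (x : X) (l : List X), x ∈ toFun l → x ∈ toFun (x :: l)
  /-- `η(x₁, …, xₙ) ⊆ η(x_{f(1)}, …, x_{f(m)})` for every nondecreasing
  `f : {1, …, m} → {1, …, n}` -/
  mono : ∀ {m n : ℕ} (x : Fin n → X) (f : Fin m → Fin n), Monotone f →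
    toFun (List.ofFn x) ≤ toFun (List.ofFn (x ∘ f))

/-- A face of the standard `n`-simplex, given by its nonempty set of vertices; inclusion of faces
is the order `≤`. -/
abbrev SimplexFace (n : ℕ) : Type := {S : Finset (Fin (n + 1)) // S.Nonempty}

namespace SimplexFace

/-- The closed face, as a set of points of the standard simplex. -/
def points {n : ℕ} (S : SimplexFace n) : Set (stdSimplex ℝ (Fin (n + 1))) :=
  {p | ∀ i, i ∉ S.1 → p i = 0}

/-- The barycenter of a face of the standard simplex. -/
noncomputable def barycenter {n : ℕ} (S : SimplexFace n) : stdSimplex ℝ (Fin (n + 1)) :=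
  ⟨fun i => if i ∈ S.1 then (S.1.card : ℝ)⁻¹ else 0, by
    constructor
    · intro i
      dsimp only
      split_ifs
      · positivity
      · exact le_rfl
    · have h : (S.1.card : ℝ) ≠ 0 := by exact_mod_cast S.2.card_pos.ne'
      simp [h]⟩

/-- The image of a face under the `i`-th coface map of standard simplices. -/
def push {n : ℕ} (i : Fin (n + 2)) (S : SimplexFace n) : SimplexFace (n + 1) :=
  ⟨S.1.map i.succAboveEmb, S.2.map⟩

theorem push_mono {n : ℕ} (i : Fin (n + 2)) : Monotone (push i) :=
  fun _ _ h => Finset.map_subset_map.2 h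

theorem stdSimplex_map_apply {n : ℕ} (i : Fin (n + 2)) (p : stdSimplex ℝ (Fin (n + 1)))
    (j : Fin (n + 2)) :
    stdSimplex.map i.succAbove p j = ∑ k, if i.succAbove k = j then p k else 0 := by
  rw [stdSimplex.map_coe, FunOnFinite.linearMap_apply_apply, Finset.sum_filter]

theorem map_barycenter {n : ℕ} (i : Fin (n + 2)) (S : SimplexFace n) :
    stdSimplex.map i.succAbove S.barycenter = (S.push i).barycenter := by
  apply stdSimplex.ext
  funext j
  rw [stdSimplex_map_apply]
  change (∑ k, if i.succAbove k = j then (if k ∈ S.1 then (S.1.card : ℝ)⁻¹ else 0) else 0) =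
    if j ∈ S.1.map i.succAboveEmb then ((S.1.map i.succAboveEmb).card : ℝ)⁻¹ else 0
  rw [Finset.card_map]
  induction j using i.succAboveCases with
  | x => simp [Fin.succAbove_ne]
  | p j => simp

theorem map_mem_points {n : ℕ} (i : Fin (n + 2)) (S : SimplexFace n)
    {p : stdSimplex ℝ (Fin (n + 1))} (hp : p ∈ S.points) :
    stdSimplex.map i.succAbove p ∈ (S.push i).points := by
  intro j hj
  rw [stdSimplex_map_apply]
  refine Finset.sum_eq_zero fun k _ => ?_
  split_ifs with h
  · subst h
    exact hp k fun hk => hj (Finset.mem_map_of_mem _ hk)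
  · rfl

end SimplexFace

/-- The singular `n`-simplices of `X`, i.e. the `n`-simplices of the singular simplicial set. -/
abbrev SingularSimplex (X : Type u) [TopologicalSpace X] (n : ℕ) : Type u :=
  (TopCat.toSSet.obj (TopCat.of X)) _⦋n⦌

/-- The continuous map `Δⁿ → X` underlying a singular simplex. -/
noncomputable def SingularSimplex.toMap {X : Type u} [TopologicalSpace X] {n : ℕ}
    (σ : SingularSimplex X n) : C(stdSimplex ℝ (Fin (n + 1)), X) :=
  TopCat.toSSetObjEquiv (TopCat.of X) (op ⦋n⦌) σ

/-- `σ : Δⁿ → X` is subordinate to `η` if `σ₁ ⊆ η(b(σ₁), …, b(σₘ))` for every chain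
`σ₁ ⊆ ⋯ ⊆ σₘ ⊆ σ` (`m ≥ 1`) of faces of `σ`, where `b` denotes the image of the barycenter. -/
def Nesting.Subordinate {X : Type u} [TopologicalSpace X] (η : Nesting X) {n : ℕ}
    (σ : C(stdSimplex ℝ (Fin (n + 1)), X)) : Prop :=
  ∀ (S : SimplexFace n) (l : List (SimplexFace n)), (S :: l).IsChain (· ≤ ·) →
    ∀ p ∈ S.points, σ p ∈ η.toFun ((S :: l).map fun T => σ T.barycenter)

/-- The singular chain complex `C_•(X)`: the free abelian groups on the singular simplices of `X`
with the alternating sum of the faces as differential. -/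
noncomputable def singularChains (X : Type u) [TopologicalSpace X] :
    ChainComplex AddCommGrpCat.{u} ℕ :=
  (AlgebraicTopology.alternatingFaceMapComplex AddCommGrpCat.{u}).obj
    (((SimplicialObject.whiskering (Type u) AddCommGrpCat.{u}).obj AddCommGrpCat.free).obj
      (TopCat.toSSet.obj (TopCat.of X)))

/-- The generator of `C_n(X)` given by a singular simplex. -/
noncomputable def singularChains.of {X : Type u} [TopologicalSpace X] {n : ℕ}
    (σ : SingularSimplex X n) : (singularChains X).X n :=
  FreeAbelianGroup.of σ

/-- The `i`-th face of a singular simplex is its composition with the `i`-th coface map. -/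
theorem SingularSimplex.toMap_δ {X : Type u} [TopologicalSpace X] {n : ℕ}
    (σ : SingularSimplex X (n + 1)) (i : Fin (n + 2)) (p : stdSimplex ℝ (Fin (n + 1))) :
    SingularSimplex.toMap ((TopCat.toSSet.obj (TopCat.of X)).δ i σ) p =
      SingularSimplex.toMap σ (stdSimplex.map i.succAbove p) :=
  rfl

theorem sum_zsmul_hom_apply {P Q : AddCommGrpCat.{u}} {m : ℕ} (a : Fin m → ℤ)
    (f : Fin m → (P ⟶ Q)) (x : P) : (∑ i, a i • f i) x = ∑ i, a i • f i x := by
  let ev : (P ⟶ Q) →+ Q :=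
    { toFun := fun f => f x
      map_zero' := rfl
      map_add' := fun _ _ => rfl }
  change ev _ = _
  rw [map_sum ev]
  exact Finset.sum_congr rfl fun i _ => map_zsmul ev _ _

theorem singularChains.d_of {X : Type u} [TopologicalSpace X] {n : ℕ}
    (σ : SingularSimplex X (n + 1)) :
    (singularChains X).d (n + 1) n (singularChains.of σ) =
      ∑ i : Fin (n + 2), (-1 : ℤ) ^ (i : ℕ) •
        singularChains.of ((TopCat.toSSet.obj (TopCat.of X)).δ i σ) := by
  have h : (singularChains X).d (n + 1) n = ∑ i : Fin (n + 2), (-1 : ℤ) ^ (i : ℕ) •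
      AddCommGrpCat.free.map ((TopCat.toSSet.obj (TopCat.of X)).δ i) :=
    AlgebraicTopology.AlternatingFaceMapComplex.obj_d_eq _ n
  refine (ConcreteCategory.congr_hom h (singularChains.of σ)).trans
    ((sum_zsmul_hom_apply _ _ _).trans (Finset.sum_congr rfl fun i _ => congrArg _ ?_))
  exact FreeAbelianGroup.map_of_apply σ

theorem Nesting.Subordinate.face {X : Type u} [TopologicalSpace X] {η : Nesting X} {n : ℕ}
    {σ : SingularSimplex X (n + 1)} (hσ : η.Subordinate σ.toMap) (i : Fin (n + 2)) :
    η.Subordinate (SingularSimplex.toMap ((TopCat.toSSet.obj (TopCat.of X)).δ i σ)) := by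
  intro S l hl p hp
  have h := hσ (S.push i) (l.map (SimplexFace.push i))
    (by
      rw [← List.map_cons]
      exact List.isChain_map_of_isChain _ (fun _ _ h => SimplexFace.push_mono i h) hl)
    _ (SimplexFace.map_mem_points i S hp)
  rw [SingularSimplex.toMap_δ]
  convert h using 2
  simp [SingularSimplex.toMap_δ, SimplexFace.map_barycenter, Function.comp_def]

/-- The subcomplex of a chain complex of abelian groups given by a family of subgroups that is
stable under the differential. -/
noncomputable def subcomplex (K : ChainComplex AddCommGrpCat.{u} ℕ)
    (M : ∀ n, AddSubgroup (K.X n)) (hM : ∀ i j, ∀ x ∈ M i, K.d i j x ∈ M j) :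
    ChainComplex AddCommGrpCat.{u} ℕ where
  X n := AddCommGrpCat.of (M n)
  d i j := AddCommGrpCat.ofHom
    (((K.d i j).hom.comp (M i).subtype).codRestrict (M j) fun x => hM i j x x.2)
  shape i j hij := by
    ext x
    simp [K.shape i j hij]
  d_comp_d' i j k _ _ := by
    ext x
    exact ConcreteCategory.congr_hom (K.d_comp_d i j k) x.1

/-- The inclusion of a subcomplex. -/
noncomputable def subcomplexι (K : ChainComplex AddCommGrpCat.{u} ℕ)
    (M : ∀ n, AddSubgroup (K.X n)) (hM : ∀ i j, ∀ x ∈ M i, K.d i j x ∈ M j) :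
    subcomplex K M hM ⟶ K where
  f n := AddCommGrpCat.ofHom (M n).subtype
  comm' _ _ _ := rfl

namespace Nesting

variable {X : Type u} [TopologicalSpace X] (η : Nesting X)

/-- The subgroup of `C_n(X)` generated by the simplices subordinate to `η`. -/
noncomputable def chainSubgroup (n : ℕ) : AddSubgroup ((singularChains X).X n) :=
  AddSubgroup.closure {c | ∃ σ : SingularSimplex X n, η.Subordinate σ.toMap ∧
    c = singularChains.of σ}

theorem of_mem_chainSubgroup {n : ℕ} {σ : SingularSimplex X n} (hσ : η.Subordinate σ.toMap) :
    singularChains.of σ ∈ η.chainSubgroup n :=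
  AddSubgroup.subset_closure ⟨σ, hσ, rfl⟩

theorem d_mem_chainSubgroup (i j : ℕ) (x : (singularChains X).X i) (hx : x ∈ η.chainSubgroup i) :
    (singularChains X).d i j x ∈ η.chainSubgroup j := by
  by_cases hij : (ComplexShape.down ℕ).Rel i j
  · obtain rfl : j + 1 = i := hij
    induction hx using AddSubgroup.closure_induction with
    | mem x hx =>
      obtain ⟨σ, hσ, rfl⟩ := hx
      rw [singularChains.d_of]
      exact AddSubgroup.sum_mem _ fun k _ => AddSubgroup.zsmul_mem _
        (η.of_mem_chainSubgroup (hσ.face k)) _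
    | zero => simp
    | add x y _ _ hx hy =>
      rw [map_add]
      exact AddSubgroup.add_mem _ hx hy
    | neg x _ hx =>
      rw [map_neg]
      exact AddSubgroup.neg_mem _ hx
  · rw [(singularChains X).shape i j hij]
    exact AddSubgroup.zero_mem _

/-- The subcomplex `C_•^η(X)` of `C_•(X)`. -/
noncomputable def chains : ChainComplex AddCommGrpCat.{u} ℕ :=
  subcomplex (singularChains X) η.chainSubgroup η.d_mem_chainSubgroup

/-- The inclusion `C_•^η(X) → C_•(X)`. -/
noncomputable def chainsι : η.chains ⟶ singularChains X :=
  subcomplexι (singularChains X) η.chainSubgroup η.d_mem_chainSubgroup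

end Nesting

/-- The cochain complex `Hom(K_•, A)` dual to a chain complex `K_•`, whose differential is
precomposition with the differential of `K_•`. -/
noncomputable def dualComplex (K : ChainComplex AddCommGrpCat.{u} ℕ) (A : Type v) [AddCommGroup A] :
    CochainComplex AddCommGrpCat.{max u v} ℕ where
  X n := AddCommGrpCat.of (K.X n →+ A)
  d i j := AddCommGrpCat.ofHom (AddMonoidHom.compHom' (K.d j i).hom)
  shape i j hij := by
    ext φ x
    have h : K.d j i x = 0 := ConcreteCategory.congr_hom (K.shape j i hij) x
    exact (congrArg (show K.X i →+ A from φ) h).trans (map_zero (show K.X i →+ A from φ))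
  d_comp_d' i j k _ _ := by
    ext φ x
    have h : K.d j i (K.d k j x) = 0 := ConcreteCategory.congr_hom (K.d_comp_d k j i) x
    exact (congrArg (show K.X i →+ A from φ) h).trans (map_zero (show K.X i →+ A from φ))

/-- The cochain map `Hom(L_•, A) → Hom(K_•, A)` dual to a chain map `f : K_• → L_•`, given by
precomposition with `f`. -/
noncomputable def dualMap {K L : ChainComplex AddCommGrpCat.{u} ℕ} (f : K ⟶ L)
    (A : Type v) [AddCommGroup A] : dualComplex L A ⟶ dualComplex K A where
  f n := AddCommGrpCat.ofHom (AddMonoidHom.compHom' (f.f n).hom)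
  comm' i j _ := by
    ext φ
    apply AddMonoidHom.ext
    intro x
    exact (congrArg (show L.X i →+ A from φ) (ConcreteCategory.congr_hom (f.comm j i) x)).symm

/-!
A subordinate simplex `σ` has to lie in `η (b)`, where `b` is the image of its own barycenter, so
iterated barycentric subdivision does not produce subordinate chains. They are produced by the
following cone construction instead. Parametrize the cone with apex `b` over a singular simplex `τ`
of a convex set so that *every* face containing the apex has its barycenter sent to `b`
(`coneMap`). If `τ` is subordinate to the nesting `l ↦ η (l, b)` and the cone lies in `η (b)`, then
the cone is subordinate to `η` (`Sub.coneMap`). Passing to `l ↦ η (l, b)` is harmless: for finitely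
many `L`, a nesting `ζ` can be chosen such that every `ζ`-subordinate simplex lying in `η (L)` is
subordinate to `l ↦ η (l, L)` (`Nesting.eventually_adapted`).

By the method of acyclic models, everything follows once the augmented complex of subordinate chains
of a standard simplex is acyclic for every nesting: `approx` then defines a retraction of the chains
onto the subordinate chains, and coning from barycenters defines a homotopy (`homotopy`) from it to
the identity. Acyclicity is proved by induction on the degree (`Valid.acyclic`), using the
approximation and the homotopy in the degrees where they are already available. Let `x` be a
subordinate cycle.

* If `ζ` is fine enough, the homotopy of `x` to its approximation by `ζ`-subordinate simplices stays
  within the subordinate chains (`Valid.eventually_homotopy_mem`), because on a subordinate simplex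
  `σ` with barycenter `b` all the cones used are tagged by `b`. Hence `x` may be replaced by a cycle
  `x'` of simplices as small as desired.
* Contracting `x'` to a point in small steps gives `x' = ∂ y` with every simplex of `y` in a convex
  set `V` with `t ∈ V ⊆ η (t)` for some `t` (`exists_fine`).
* If `ζ` is fine enough, the `ζ`-approximation of the boundary of such a simplex is subordinate to
  `l ↦ η (l, t)`, and so bounds the subordinate cone with apex `t`
  (`Valid.eventually_exists_bd_eq_extend`). Hence the `ζ`-approximation of `x'`, which is homologous
  to `x'`, is a boundary.

"Fine enough" is expressed by `∀ᶠ ζ in Filter.atBot` for the pointwise order on nestings.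
-/

/-! ### Nestings -/

/-- `Reindexes l l'` holds when `l'` is the list of the values `l[f 0], l[f 1], …` for some
nondecreasing `f`: entries of `l` may be dropped and may be repeated in place. -/
inductive Reindexes {X : Type u} : List X → List X → Prop where
  /-- the empty list -/
  | nil : Reindexes [] []
  /-- dropping an entry -/
  | drop (x : X) {l l' : List X} : Reindexes l l' → Reindexes (x :: l) l'
  /-- repeating an entry -/
  | rep (x : X) {l l' : List X} : Reindexes (x :: l) l' → Reindexes (x :: l) (x :: l')

namespace Reindexes

variable {X : Type u}

theorem cons (x : X) {l l' : List X} (h : Reindexes l l') : Reindexes (x :: l) (x :: l') :=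
  (h.drop x).rep x

theorem refl (l : List X) : Reindexes l l := by
  induction l with
  | nil => exact .nil
  | cons x l ih => exact ih.cons x

theorem to_nil (l : List X) : Reindexes l [] := by
  induction l with
  | nil => exact .nil
  | cons x l ih => exact ih.drop x

theorem append_left (k : List X) {l l' : List X} (h : Reindexes l l') :
    Reindexes (k ++ l) (k ++ l') := by
  induction k with
  | nil => exact h
  | cons x k ih => exact ih.cons x

theorem append_right (k : List X) {l l' : List X} (h : Reindexes l l') :
    Reindexes (l ++ k) (l' ++ k) := by
  induction h with
  | nil => exact refl k
  | drop x _ ih => exact ih.drop x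
  | rep x _ ih => exact ih.rep x

theorem map {Y : Type v} (f : X → Y) {l l' : List X} (h : Reindexes l l') :
    Reindexes (l.map f) (l'.map f) := by
  induction h with
  | nil => exact .nil
  | drop x _ ih => exact ih.drop (f x)
  | rep x _ ih => exact ih.rep (f x)

theorem filter (p : X → Bool) {l l' : List X} (h : Reindexes l l') :
    Reindexes (l.filter p) (l'.filter p) := by
  induction h with
  | nil => exact .nil
  | drop x _ ih =>
    rw [List.filter_cons]
    split_ifs
    · exact ih.drop x
    · exact ih
  | rep x _ ih =>
    rw [List.filter_cons] at ih ⊢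
    rw [List.filter_cons]
    split_ifs with hx
    · rw [if_pos hx] at ih
      exact ih.rep x
    · rwa [if_neg hx] at ih

theorem mem {l l' : List X} (h : Reindexes l l') {x : X} (hx : x ∈ l') : x ∈ l := by
  induction h with
  | nil => exact hx
  | drop y _ ih => exact List.mem_cons_of_mem y (ih hx)
  | rep y _ ih =>
    rcases List.mem_cons.1 hx with rfl | hx
    · exact List.mem_cons_self
    · exact ih hx

theorem eq_nil {l' : List X} (h : Reindexes [] l') : l' = [] := by
  cases h
  rfl

theorem replicate_append (x : X) (l : List X) (k : ℕ) :
    Reindexes (x :: l) (List.replicate k x ++ l) := by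
  induction k with
  | zero => exact (refl l).drop x
  | succ k ih => exact ih.rep x

/-- A reindexing in the sense of `Reindexes` is given by a nondecreasing map of index sets. -/
theorem exists_monotone {l l' : List X} (h : Reindexes l l') :
    ∃ f : Fin l'.length → Fin l.length, Monotone f ∧ l'.get = l.get ∘ f := by
  induction h with
  | nil => exact ⟨id, monotone_id, rfl⟩
  | drop x _ ih =>
    obtain ⟨f, hf, h⟩ := ih
    refine ⟨fun i => (f i).succ, fun i j hij => Fin.succ_le_succ_iff.2 (hf hij), ?_⟩
    rw [h]
    rfl
  | @rep x l l' _ ih =>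
    obtain ⟨f, hf, h⟩ := ih
    refine ⟨Fin.cons (0 : Fin (l.length + 1)) f, ?_, ?_⟩
    · intro i j hij
      induction i using Fin.cases with
      | zero => exact Fin.zero_le _
      | succ i =>
        induction j using Fin.cases with
        | zero => exact absurd hij (by simp)
        | succ j => exact hf (Fin.succ_le_succ_iff.1 hij)
    · funext i
      induction i using Fin.cases with
      | zero => rfl
      | succ i => exact congrFun h i

theorem ofFn {n m : ℕ} (x : Fin n → X) (f : Fin m → Fin n) (hf : Monotone f) :
    Reindexes (List.ofFn x) (List.ofFn (x ∘ f)) := by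
  induction n generalizing m with
  | zero =>
    obtain rfl : m = 0 := Nat.eq_zero_of_not_pos fun hm => (f ⟨0, hm⟩).elim0
    simpa using Reindexes.nil
  | succ n ihn =>
    induction m with
    | zero => simpa using to_nil _
    | succ m ihm =>
      by_cases h0 : f 0 = 0
      · have h := ihm (f ∘ Fin.succ) (hf.comp Fin.strictMono_succ.monotone)
        rw [List.ofFn_succ] at h ⊢
        rw [List.ofFn_succ (f := x ∘ f), Function.comp_apply, h0]
        exact h.rep _
      · have hpos (i) : f i ≠ 0 := fun hi =>
          h0 (le_antisymm (hi ▸ hf (Fin.zero_le i)) (Fin.zero_le _))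
        have h := ihn (x ∘ Fin.succ) (fun i => (f i).pred (hpos i))
          fun i j hij => Fin.pred_le_pred_iff.2 (hf hij)
        have hx : x ∘ f = (x ∘ Fin.succ) ∘ fun i => (f i).pred (hpos i) := by
          funext i
          simp
        rw [hx, List.ofFn_succ]
        exact h.drop (x 0)

end Reindexes

namespace Nesting

variable {X : Type u} [TopologicalSpace X]

/-- The values of a nesting as sets, without the bundled openness. -/
def ctrl (η : Nesting X) (l : List X) : Set X := η.toFun l

theorem antitone (η : Nesting X) {l l' : List X} (h : Reindexes l l') : η.ctrl l ⊆ η.ctrl l' := by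
  obtain ⟨f, hf, hl⟩ := h.exists_monotone
  have := η.mono l.get f hf
  rwa [← hl, List.ofFn_get, List.ofFn_get] at this

/-- A nesting from a family of open sets that is antitone under reindexing of lists. -/
def mk' (φ : List X → TopologicalSpace.Opens X) (nil : φ [] = ⊤)
    (mem_cons : ∀ (x : X) (l : List X), x ∈ φ l → x ∈ φ (x :: l))
    (anti : ∀ {l l' : List X}, Reindexes l l' → φ l ≤ φ l') : Nesting X where
  toFun := φ
  nil := nil
  mem_cons := mem_cons
  mono x f hf := anti (Reindexes.ofFn x f hf)

/-- The preimage of a nesting under a continuous map. -/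
def comap {Y : Type v} [TopologicalSpace Y] (f : C(Y, X)) (η : Nesting X) : Nesting Y :=
  mk' (fun l => (η.toFun (l.map f)).comap f) (by simp [η.nil])
    (fun x l hx => η.mem_cons (f x) (l.map f) hx)
    (fun h _ hx => η.antitone (h.map f) hx)

/-- The nesting sending a list to the intersection of the given neighbourhoods of its entries. -/
def ofNhds (W : X → TopologicalSpace.Opens X) (hW : ∀ x, x ∈ W x) : Nesting X :=
  mk' (fun l => l.foldr (fun x V => W x ⊓ V) ⊤) rfl (fun x _ hx => ⟨hW x, hx⟩) (by
    intro l l' h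
    have key : ∀ (l : List X) (y : X), y ∈ l.foldr (fun x V => W x ⊓ V) ⊤ ↔ ∀ x ∈ l, y ∈ W x := by
      intro l y
      induction l with
      | nil => simp
      | cons x l ih =>
        rw [List.foldr_cons, List.forall_mem_cons, ← ih]
        rfl
    intro y hy
    rw [key] at hy ⊢
    exact fun x hx => hy x (h.mem hx))

instance : Preorder (Nesting X) := Preorder.lift Nesting.toFun

instance : Nonempty (Nesting X) := ⟨ofNhds (fun _ => ⊤) fun _ => trivial⟩

theorem ctrl_subset {ζ η : Nesting X} (h : ζ ≤ η) (l : List X) : ζ.ctrl l ⊆ η.ctrl l := h l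

instance : IsCodirectedOrder (Nesting X) where
  directed η ζ := ⟨mk' (fun l => η.toFun l ⊓ ζ.toFun l) (by simp [η.nil, ζ.nil])
    (fun x l hx => ⟨η.mem_cons x l hx.1, ζ.mem_cons x l hx.2⟩)
    (fun h => inf_le_inf (η.antitone h) (ζ.antitone h)),
    fun _ => inf_le_left, fun _ => inf_le_right⟩

/-- `Adapted ζ η L`: a `ζ`-small set all of whose tags lie in `η(L)` is small for the nesting
`l ↦ η(l, L)` on `η(L)`. -/
def Adapted (ζ η : Nesting X) (L : List X) : Prop :=
  ∀ l : List X, l ≠ [] → (∀ x ∈ l, x ∈ η.ctrl L) → ζ.ctrl l ⊆ η.ctrl (l ++ L)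

open Classical in
/-- The coarsest nesting adapted to `η` and `L`: points outside of `η(L)` are left out of the
lists. -/
noncomputable def adapt (η : Nesting X) (L : List X) : Nesting X :=
  mk' (fun l => if l.filter (· ∈ η.ctrl L) = [] then ⊤ else η.toFun (l.filter (· ∈ η.ctrl L) ++ L))
    (by simp)
    (by
      intro x l hx
      by_cases hxL : x ∈ η.ctrl L
      · rw [List.filter_cons_of_pos (by simpa using hxL), if_neg (by simp)]
        refine η.mem_cons _ _ ?_
        split_ifs at hx with h
        · rw [h]
          exact hxL
        · exact hx
      · rwa [List.filter_cons_of_neg (by simpa using hxL)])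
    (by
      intro l l' h
      have hf := h.filter (· ∈ η.ctrl L)
      by_cases h' : l'.filter (· ∈ η.ctrl L) = []
      · rw [if_pos h']
        exact le_top
      · rw [if_neg h', if_neg]
        · exact η.antitone (hf.append_right L)
        · intro h0
          rw [h0] at hf
          exact h' hf.eq_nil)

theorem adapted_adapt (η : Nesting X) (L : List X) : Adapted (η.adapt L) η L := by
  classical
  intro l hl hL y hy
  have h : l.filter (· ∈ η.ctrl L) = l := List.filter_eq_self.2 fun x hx => by simpa using hL x hx
  change y ∈ (if l.filter (· ∈ η.ctrl L) = [] then ⊤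
    else η.toFun (l.filter (· ∈ η.ctrl L) ++ L) : TopologicalSpace.Opens X) at hy
  rwa [h, if_neg hl] at hy

theorem eventually_adapted (η : Nesting X) (L : List X) : ∀ᶠ ζ in Filter.atBot, Adapted ζ η L :=
  (Filter.eventually_le_atBot (η.adapt L)).mono fun _ hζ l hl hL =>
    (ctrl_subset hζ l).trans (η.adapted_adapt L l hl hL)

end Nesting

/-! ### Augmented singular chains -/

namespace SmallChains

/-- The standard simplex with `n` vertices. For `n = 0` it is empty, so that every space has
exactly one singular simplex without vertices; this makes the chains below augmented. -/
abbrev Spx (n : ℕ) : Type := stdSimplex ℝ (Fin n)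

/-- The inclusion of the face opposite to the vertex `i`. -/
noncomputable def coface {n : ℕ} (i : Fin (n + 1)) : C(Spx n, Spx (n + 1)) :=
  ⟨stdSimplex.map i.succAbove, stdSimplex.continuous_map _⟩

theorem coface_apply {n : ℕ} (i j : Fin (n + 1)) (p : Spx n) :
    coface i p j = ∑ k, if i.succAbove k = j then p k else 0 := by
  change stdSimplex.map i.succAbove p j = _
  rw [stdSimplex.map_coe, FunOnFinite.linearMap_apply_apply, Finset.sum_filter]

@[simp]
theorem coface_apply_self {n : ℕ} (i : Fin (n + 1)) (p : Spx n) : coface i p i = 0 := by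
  simp [coface_apply, Fin.succAbove_ne]

@[simp]
theorem coface_apply_succAbove {n : ℕ} (i : Fin (n + 1)) (p : Spx n) (k : Fin n) :
    coface i p (i.succAbove k) = p k := by
  simp [coface_apply]

theorem coface_comp_coface {n : ℕ} (i : Fin (n + 2)) (j : Fin (n + 1)) :
    (coface i).comp (coface j) = (coface (i.succAbove j)).comp (coface (j.predAbove i)) := by
  ext1 p
  change stdSimplex.map _ (stdSimplex.map _ p) = stdSimplex.map _ (stdSimplex.map _ p)
  rw [stdSimplex.map_comp_apply, stdSimplex.map_comp_apply]
  congr 1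
  funext k
  exact (Fin.succAbove_succAbove_succAbove_predAbove i j k).symm

/-- Singular chains on simplices with `n` vertices. -/
abbrev Chains (X : Type u) [TopologicalSpace X] (n : ℕ) : Type u :=
  FreeAbelianGroup C(Spx n, X)

section

variable {X : Type u} [TopologicalSpace X] {Y : Type v} [TopologicalSpace Y]

/-- The boundary map. -/
noncomputable def bd (n : ℕ) : Chains X (n + 1) →+ Chains X n :=
  FreeAbelianGroup.lift fun σ =>
    ∑ i : Fin (n + 1), (-1 : ℤ) ^ (i : ℕ) • FreeAbelianGroup.of (σ.comp (coface i))

theorem bd_of {n : ℕ} (σ : C(Spx (n + 1), X)) : bd n (FreeAbelianGroup.of σ) =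
    ∑ i : Fin (n + 1), (-1 : ℤ) ^ (i : ℕ) • FreeAbelianGroup.of (σ.comp (coface i)) :=
  FreeAbelianGroup.lift_apply_of _ _

theorem bd_bd {n : ℕ} (x : Chains X (n + 2)) : bd n (bd (n + 1) x) = 0 := by
  induction x using FreeAbelianGroup.induction_on with
  | zero => simp
  | of σ =>
    simp only [bd_of, map_sum, map_zsmul, Finset.smul_sum, smul_smul, ← Finset.sum_product',
      Finset.univ_product_univ]
    -- the faces `(i, j)` and `(i.succAbove j, j.predAbove i)` cancel
    refine Finset.sum_involution (fun p _ => (p.1.succAbove p.2, p.2.predAbove p.1)) ?_ ?_ ?_ ?_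
    · rintro ⟨i, j⟩ -
      dsimp only
      rw [ContinuousMap.comp_assoc, ContinuousMap.comp_assoc, ← coface_comp_coface, ← pow_add,
        ← pow_add, Fin.neg_one_pow_succAbove_add_predAbove, neg_smul, add_neg_cancel]
    · rintro ⟨i, j⟩ - - h
      exact Fin.succAbove_ne _ _ (congrArg Prod.fst h)
    · simp
    · rintro ⟨i, j⟩ -
      exact Prod.ext (Fin.succAbove_succAbove_predAbove i j)
        (Fin.predAbove_predAbove_succAbove i j)
  | neg x hx => simp [hx]
  | add x y hx hy => simp [hx, hy]

/-- The chain map induced by a continuous map. -/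
noncomputable def push (f : C(X, Y)) {n : ℕ} : Chains X n →+ Chains Y n :=
  FreeAbelianGroup.map fun σ => f.comp σ

@[simp]
theorem push_of (f : C(X, Y)) {n : ℕ} (σ : C(Spx n, X)) :
    push f (FreeAbelianGroup.of σ) = FreeAbelianGroup.of (f.comp σ) :=
  FreeAbelianGroup.map_of_apply σ

theorem push_push {Z : Type*} [TopologicalSpace Z] (g : C(Y, Z)) (f : C(X, Y)) {n : ℕ}
    (x : Chains X n) : push g (push f x) = push (g.comp f) x := by
  induction x using FreeAbelianGroup.induction_on with
  | zero => simp
  | of σ => simp [ContinuousMap.comp_assoc]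
  | neg x hx => simp only [map_neg, hx]
  | add x y hx hy => simp only [map_add, hx, hy]

theorem bd_push (f : C(X, Y)) {n : ℕ} (x : Chains X (n + 1)) :
    bd n (push f x) = push f (bd n x) := by
  induction x using FreeAbelianGroup.induction_on with
  | zero => simp
  | of σ => simp [bd_of, ContinuousMap.comp_assoc]
  | neg x hx => simp only [map_neg, hx]
  | add x y hx hy => simp only [map_add, hx, hy]

end

/-! ### Cones -/

/-- The point dividing the segment from `b` to `y` in the ratio `t : 1 - t`. -/
noncomputable def lin {N : ℕ} (b y : Spx N) (t : ℝ) (ht : t ∈ Set.Icc (0 : ℝ) 1) : Spx N :=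
  ⟨(1 - t) • b.1 + t • y.1,
    convex_stdSimplex ℝ (Fin N) b.2 y.2 (sub_nonneg.2 ht.2) ht.1 (sub_add_cancel 1 t)⟩

/-- The amount by which the weight of the vertex `i + 1` exceeds the weight of the apex `0`. -/
noncomputable def excess {n : ℕ} (s : Spx (n + 1)) (i : Fin n) : ℝ := max (s i.succ - s 0) 0

/-- The total excess, which is the radial coordinate of the cone. -/
noncomputable def mass {n : ℕ} (s : Spx (n + 1)) : ℝ := ∑ i, excess s i

theorem excess_nonneg {n : ℕ} (s : Spx (n + 1)) (i : Fin n) : 0 ≤ excess s i := le_max_right _ _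

theorem mass_nonneg {n : ℕ} (s : Spx (n + 1)) : 0 ≤ mass s :=
  Finset.sum_nonneg fun i _ => excess_nonneg s i

theorem mass_le_one {n : ℕ} (s : Spx (n + 1)) : mass s ≤ 1 := by
  have h : ∑ i, s i = 1 := stdSimplex.sum_eq_one s
  rw [Fin.sum_univ_succ] at h
  have h0 : 0 ≤ s 0 := stdSimplex.zero_le s 0
  calc mass s ≤ ∑ i : Fin n, s i.succ := Finset.sum_le_sum fun i _ =>
        max_le (sub_le_self _ h0) (stdSimplex.zero_le s _)
    _ ≤ 1 := by linarith

theorem mass_mem {n : ℕ} (s : Spx (n + 1)) : mass s ∈ Set.Icc (0 : ℝ) 1 :=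
  ⟨mass_nonneg s, mass_le_one s⟩

/-- The projection from the apex to the opposite face, off the locus where the excess vanishes. -/
noncomputable def link {n : ℕ} (s : Spx (n + 1)) (h : 0 < mass s) : Spx n :=
  ⟨fun i => excess s i / mass s, fun i => div_nonneg (excess_nonneg s i) h.le, by
    rw [← Finset.sum_div]
    exact div_self h.ne'⟩

theorem continuous_coord {n : ℕ} (i : Fin n) : Continuous fun s : Spx n => s i :=
  (continuous_apply i).comp continuous_subtype_val

theorem continuous_excess {n : ℕ} (i : Fin n) : Continuous fun s : Spx (n + 1) => excess s i :=
  ((continuous_coord _).sub (continuous_coord _)).max continuous_const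

theorem continuous_mass {n : ℕ} : Continuous fun s : Spx (n + 1) => mass s :=
  continuous_finsetSum _ fun i _ => continuous_excess i

/-- The underlying function of `coneMap`. -/
noncomputable def coneFun {N n : ℕ} (b : Spx N) (τ : C(Spx n, Spx N)) (s : Spx (n + 1)) : Spx N :=
  if h : 0 < mass s then lin b (τ (link s h)) (mass s) (mass_mem s) else b

theorem coneFun_of_pos {N n : ℕ} (b : Spx N) (τ : C(Spx n, Spx N)) {s : Spx (n + 1)}
    (h : 0 < mass s) : coneFun b τ s = lin b (τ (link s h)) (mass s) (mass_mem s) := dif_pos h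

theorem coneFun_of_eq_zero {N n : ℕ} (b : Spx N) (τ : C(Spx n, Spx N)) {s : Spx (n + 1)}
    (h : mass s = 0) : coneFun b τ s = b := dif_neg h.not_gt

theorem abs_coneFun_sub_le {N n : ℕ} (b : Spx N) (τ : C(Spx n, Spx N)) (s : Spx (n + 1))
    (k : Fin N) : abs (coneFun b τ s k - b k) ≤ mass s := by
  by_cases h : 0 < mass s
  · rw [coneFun_of_pos b τ h]
    change abs ((1 - mass s) * b k + mass s * τ (link s h) k - b k) ≤ _
    have e : (1 - mass s) * b k + mass s * τ (link s h) k - b k =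
      mass s * (τ (link s h) k - b k) := by ring
    rw [e, abs_mul, abs_of_pos h]
    refine mul_le_of_le_one_right h.le (abs_le.2 ?_)
    have h1 := stdSimplex.zero_le b k
    have h2 := stdSimplex.le_one b k
    have h3 := stdSimplex.zero_le (τ (link s h)) k
    have h4 := stdSimplex.le_one (τ (link s h)) k
    constructor <;> linarith
  · rw [coneFun_of_eq_zero b τ (le_antisymm (not_lt.1 h) (mass_nonneg s)), sub_self, abs_zero]
    exact mass_nonneg s

theorem continuous_coneFun {N n : ℕ} (b : Spx N) (τ : C(Spx n, Spx N)) :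
    Continuous (coneFun b τ) := by
  rw [continuous_iff_continuousAt]
  intro s
  by_cases h : 0 < mass s
  · let U : Set (Spx (n + 1)) := mass ⁻¹' Set.Ioi 0
    have hU : IsOpen U := isOpen_Ioi.preimage continuous_mass
    suffices ContinuousOn (coneFun b τ) U from
      this.continuousAt (hU.mem_nhds h)
    rw [continuousOn_iff_continuous_domRestrict]
    have hlink : Continuous fun s : U => link s.1 s.2 :=
      Continuous.subtype_mk (continuous_pi fun i =>
        ((continuous_excess i).comp continuous_subtype_val).div
          (continuous_mass.comp continuous_subtype_val) fun s => (ne_of_gt s.2)) _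
    have e : Set.domRestrict U (coneFun b τ) =
        fun s => lin b (τ (link s.1 s.2)) (mass s.1) (mass_mem s.1) :=
      funext fun s => coneFun_of_pos b τ s.2
    rw [e]
    have hm : Continuous fun s : U => mass s.1 :=
      continuous_mass.comp continuous_subtype_val
    exact Continuous.subtype_mk (((continuous_const.sub hm).smul continuous_const).add
      (hm.smul (continuous_subtype_val.comp (τ.continuous.comp hlink)))) _
  · have h0 : mass s = 0 := le_antisymm (not_lt.1 h) (mass_nonneg s)
    rw [ContinuousAt, coneFun_of_eq_zero b τ h0, tendsto_subtype_rng, tendsto_pi_nhds]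
    intro k
    rw [tendsto_iff_dist_tendsto_zero]
    have hm : Filter.Tendsto (fun s : Spx (n + 1) => mass s) (nhds s) (nhds 0) :=
      h0 ▸ continuous_mass.tendsto s
    exact squeeze_zero (fun _ => dist_nonneg) (fun t => abs_coneFun_sub_le b τ t k) hm

/-- The cone with apex `b` over a simplex `τ` of a standard simplex. The apex is the vertex `0`,
and the radial coordinate is chosen such that every face that contains the vertex `0` has its
barycenter sent to `b`. -/
noncomputable def coneMap {N n : ℕ} (b : Spx N) (τ : C(Spx n, Spx N)) : C(Spx (n + 1), Spx N) :=
  ⟨coneFun b τ, continuous_coneFun b τ⟩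

theorem coneMap_of_mass_eq_zero {N n : ℕ} (b : Spx N) (τ : C(Spx n, Spx N)) {s : Spx (n + 1)}
    (h : mass s = 0) : coneMap b τ s = b := coneFun_of_eq_zero b τ h

/-- A set of points of a standard simplex that contains the segments between its points. -/
def IsConvex {N : ℕ} (V : Set (Spx N)) : Prop :=
  ∀ b ∈ V, ∀ y ∈ V, ∀ t ht, lin b y t ht ∈ V

theorem coneMap_mem {N n : ℕ} {V : Set (Spx N)} (hV : IsConvex V) {b : Spx N} (hb : b ∈ V)
    {τ : C(Spx n, Spx N)} (hτ : ∀ p, τ p ∈ V) (s : Spx (n + 1)) : coneMap b τ s ∈ V := by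
  change coneFun b τ s ∈ V
  by_cases h : 0 < mass s
  · rw [coneFun_of_pos b τ h]
    exact hV b hb _ (hτ _) _ _
  · rwa [coneFun_of_eq_zero b τ (le_antisymm (not_lt.1 h) (mass_nonneg s))]

theorem excess_coface_zero {n : ℕ} (p : Spx n) (i : Fin n) : excess (coface 0 p) i = p i := by
  have h : coface 0 p i.succ = p i := coface_apply_succAbove 0 p i
  rw [excess, h, coface_apply_self, sub_zero, max_eq_left (stdSimplex.zero_le p i)]

theorem coneMap_comp_coface_zero {N n : ℕ} (b : Spx N) (τ : C(Spx n, Spx N)) :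
    (coneMap b τ).comp (coface 0) = τ := by
  ext1 p
  have hm : mass (coface 0 p) = 1 := by
    simp only [mass, excess_coface_zero]
    exact stdSimplex.sum_eq_one p
  have hpos : 0 < mass (coface 0 p) := hm ▸ one_pos
  have hl : link (coface 0 p) hpos = p := by
    apply stdSimplex.ext
    funext i
    change excess (coface 0 p) i / mass (coface 0 p) = p i
    rw [hm, excess_coface_zero, div_one]
  change coneFun b τ (coface 0 p) = τ p
  rw [coneFun_of_pos b τ hpos, hl]
  apply stdSimplex.ext
  funext i
  change (1 - mass (coface 0 p)) * b i + mass (coface 0 p) * τ p i = τ p i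
  rw [hm]
  ring

theorem excess_coface_succ {n : ℕ} (j : Fin (n + 1)) (s : Spx (n + 1)) (k : Fin n) :
    excess (coface j.succ s) (j.succAbove k) = excess s k := by
  have h : coface j.succ s (j.succAbove k).succ = s k.succ := by
    rw [← Fin.succ_succAbove_succ, coface_apply_succAbove]
  have h0 : coface j.succ s 0 = s 0 := by
    conv_lhs => rw [← Fin.succ_succAbove_zero j, coface_apply_succAbove]
  rw [excess, h, h0, excess]

theorem excess_coface_succ_self {n : ℕ} (j : Fin (n + 1)) (s : Spx (n + 1)) :
    excess (coface j.succ s) j = 0 := by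
  have h0 : coface j.succ s 0 = s 0 := by
    conv_lhs => rw [← Fin.succ_succAbove_zero j, coface_apply_succAbove]
  rw [excess, coface_apply_self, h0]
  exact max_eq_right (by simp)

theorem coneMap_comp_coface_succ {N n : ℕ} (b : Spx N) (τ : C(Spx (n + 1), Spx N))
    (j : Fin (n + 1)) :
    (coneMap b τ).comp (coface j.succ) = coneMap b (τ.comp (coface j)) := by
  ext1 s
  have hm : mass (coface j.succ s) = mass s := by
    simp only [mass]
    rw [Fin.sum_univ_succAbove _ j, excess_coface_succ_self, zero_add]
    simp only [excess_coface_succ]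
  change coneFun b τ (coface j.succ s) = coneFun b (τ.comp (coface j)) s
  by_cases h : 0 < mass s
  · rw [coneFun_of_pos b _ h, coneFun_of_pos b τ (hm ▸ h)]
    have hl : link (coface j.succ s) (hm ▸ h) = coface j (link s h) := by
      apply stdSimplex.ext
      funext i
      change excess (coface j.succ s) i / mass (coface j.succ s) = _
      induction i using j.succAboveCases with
      | x => rw [coface_apply_self, excess_coface_succ_self, zero_div]
      | p i =>
        rw [coface_apply_succAbove, excess_coface_succ, hm]
        rfl
    simp only [hl, hm, ContinuousMap.comp_apply]
  · have h0 : mass s = 0 := le_antisymm (not_lt.1 h) (mass_nonneg s)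
    rw [coneFun_of_eq_zero b _ h0, coneFun_of_eq_zero b τ (hm.trans h0)]

/-- The linear extension of `coneMap` to chains. -/
noncomputable def cone {N n : ℕ} (b : Spx N) : Chains (Spx N) n →+ Chains (Spx N) (n + 1) :=
  FreeAbelianGroup.map (coneMap b)

@[simp]
theorem cone_of {N n : ℕ} (b : Spx N) (τ : C(Spx n, Spx N)) :
    cone b (FreeAbelianGroup.of τ) = FreeAbelianGroup.of (coneMap b τ) :=
  FreeAbelianGroup.map_of_apply τ

theorem bd_cone {N n : ℕ} (b : Spx N) (x : Chains (Spx N) (n + 1)) :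
    bd (n + 1) (cone b x) = x - cone b (bd n x) := by
  induction x using FreeAbelianGroup.induction_on with
  | zero => simp
  | of τ =>
    rw [cone_of, bd_of, Fin.sum_univ_succ, coneMap_comp_coface_zero, bd_of, map_sum, sub_eq_add_neg,
      ← Finset.sum_neg_distrib]
    congr 1
    · refine Finset.sum_congr rfl fun j _ => ?_
      rw [coneMap_comp_coface_succ, map_zsmul, cone_of, Fin.val_succ, pow_succ, mul_neg_one,
        neg_smul]
  | neg x hx =>
    simp only [map_neg, hx]
    abel
  | add x y hx hy =>
    simp only [map_add, hx, hy]
    abel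

end SmallChains

/-! ### Subordinate simplices -/

namespace SmallChains

/-- A face of the standard simplex with `n` vertices. -/
abbrev Face (n : ℕ) : Type := {S : Finset (Fin n) // S.Nonempty}

/-- The barycenter of a face. -/
noncomputable def bary {n : ℕ} (S : Face n) : Spx n :=
  ⟨fun i => if i ∈ S.1 then (S.1.card : ℝ)⁻¹ else 0, by
    constructor
    · intro i
      dsimp only
      split_ifs
      · positivity
      · exact le_rfl
    · have h : (S.1.card : ℝ) ≠ 0 := by exact_mod_cast S.2.card_pos.ne'
      simp [h]⟩

theorem bary_apply {n : ℕ} (S : Face n) (i : Fin n) :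
    bary S i = if i ∈ S.1 then (S.1.card : ℝ)⁻¹ else 0 := rfl

/-- The image of a face under `coface i`. -/
def pushFace {n : ℕ} (i : Fin (n + 1)) (S : Face n) : Face (n + 1) :=
  ⟨S.1.map i.succAboveEmb, S.2.map⟩

theorem pushFace_le {n : ℕ} (i : Fin (n + 1)) {S T : Face n} :
    pushFace i S ≤ pushFace i T ↔ S ≤ T := Finset.map_subset_map

theorem coface_bary {n : ℕ} (i : Fin (n + 1)) (S : Face n) :
    coface i (bary S) = bary (pushFace i S) := by
  apply stdSimplex.ext
  funext j
  induction j using i.succAboveCases with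
  | x =>
    rw [coface_apply_self, bary_apply, if_neg]
    simp [pushFace, Fin.succAbove_ne]
  | p j =>
    rw [coface_apply_succAbove, bary_apply, bary_apply]
    simp [pushFace]

/-- The face consisting of all vertices. -/
def topFace (n : ℕ) : Face (n + 1) := ⟨Finset.univ, Finset.univ_nonempty⟩

theorem le_topFace {n : ℕ} (S : Face (n + 1)) : S ≤ topFace n := Finset.subset_univ S.1

/-- The barycenter of the standard simplex. -/
noncomputable def center (n : ℕ) : Spx (n + 1) := bary (topFace n)

variable {X : Type u} {Y : Type v}

/-- `shift θ L` is the family of sets `l ↦ θ (l, L)`. -/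
def shift (θ : List X → Set X) (L : List X) (l : List X) : Set X := θ (l ++ L)

theorem shift_shift (θ : List X → Set X) (L L' : List X) :
    shift (shift θ L) L' = shift θ (L' ++ L) :=
  funext fun l => congrArg θ (List.append_assoc l L' L)

theorem shift_nil (θ : List X → Set X) : shift θ [] = θ :=
  funext fun l => congrArg θ (List.append_nil l)

/-- The preimage under `f` of a family of sets indexed by lists. -/
def pull (f : X → Y) (θ : List Y → Set Y) (l : List X) : Set X := f ⁻¹' θ (l.map f)

theorem pull_pull {Z : Type*} (f : X → Y) (g : Y → Z) (θ : List Z → Set Z) :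
    pull f (pull g θ) = pull (g ∘ f) θ := by
  funext l
  simp [pull, Set.preimage_comp]

theorem pull_shift (f : X → Y) (θ : List Y → Set Y) (L : List X) :
    pull f (shift θ (L.map f)) = shift (pull f θ) L := by
  funext l
  simp [pull, shift]

variable [TopologicalSpace X] [TopologicalSpace Y]

/-- The condition of being subordinate to a nesting, for an arbitrary family `θ` of sets indexed by
lists in place of a nesting. -/
def Sub (θ : List X → Set X) {n : ℕ} (σ : C(Spx n, X)) : Prop :=
  ∀ (S : Face n) (l : List (Face n)), (S :: l).IsChain (· ≤ ·) →
    ∀ p : Spx n, (∀ i, i ∉ S.1 → p i = 0) → σ p ∈ θ ((S :: l).map fun T => σ (bary T))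

theorem Sub.mono {θ θ' : List X → Set X} {n : ℕ} {σ : C(Spx n, X)} (h : Sub θ σ)
    (hθ : ∀ l, l ≠ [] → (∀ x ∈ l, x ∈ Set.range σ) → θ l ⊆ θ' l) : Sub θ' σ :=
  fun S l hl p hp => hθ _ (List.cons_ne_nil _ _)
    (fun _ hx => (List.mem_map (l := S :: l).1 hx).elim fun T hT => ⟨bary T, hT.2⟩) (h S l hl p hp)

theorem sub_comp {θ : List Y → Set Y} {n : ℕ} {f : C(X, Y)} {σ : C(Spx n, X)} :
    Sub θ (f.comp σ) ↔ Sub (pull f θ) σ := by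
  simp only [Sub, pull, List.map_map, Set.mem_preimage]
  rfl

theorem subordinate_empty (θ : List X → Set X) (σ : C(Spx 0, X)) : Sub θ σ :=
  fun S => S.2.elim fun i => i.elim0

theorem Sub.face {θ : List X → Set X} {n : ℕ} {σ : C(Spx (n + 1), X)} (h : Sub θ σ)
    (i : Fin (n + 1)) : Sub θ (σ.comp (coface i)) := by
  intro S l hl p hp
  have := h (pushFace i S) (l.map (pushFace i))
    (by
      rw [← List.map_cons]
      exact List.isChain_map_of_isChain _ (fun _ _ h => (pushFace_le i).2 h) hl)
    (coface i p) (by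
      intro j hj
      induction j using i.succAboveCases with
      | x => exact coface_apply_self i p
      | p j =>
        rw [coface_apply_succAbove]
        exact hp j fun h => hj (Finset.mem_map_of_mem _ h))
  rw [← List.map_cons, List.map_map] at this
  simp only [Function.comp_def, ← coface_bary] at this
  exact this

theorem Sub.shift_center {θ : List X → Set X} {n : ℕ} {σ : C(Spx (n + 1), X)} (h : Sub θ σ) :
    Sub (shift θ [σ (center n)]) σ := by
  intro S l hl p hp
  have hl' : (S :: (l ++ [topFace n])).IsChain (· ≤ ·) := by
    rw [← List.cons_append, List.isChain_append]
    refine ⟨hl, List.isChain_singleton _, fun x _ y hy => ?_⟩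
    obtain rfl : y = topFace n := by simpa using hy.symm
    exact le_topFace x
  have := h S (l ++ [topFace n]) hl' p hp
  rwa [← List.cons_append, List.map_append] at this

theorem Sub.apply_mem {θ : List X → Set X} {n : ℕ} {σ : C(Spx (n + 1), X)} (h : Sub θ σ)
    (p : Spx (n + 1)) : σ p ∈ θ [σ (center n)] :=
  h (topFace n) [] (List.isChain_singleton _) p fun i hi => absurd (Finset.mem_univ i) hi

theorem Sub.inter {θ : List X → Set X} {n : ℕ} {σ : C(Spx n, X)} (h : Sub θ σ) {V : Set X}
    (hV : ∀ p, σ p ∈ V) : Sub (fun l => θ l ∩ V) σ :=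
  fun S l hl p hp => ⟨h S l hl p hp, hV p⟩

theorem sub_const {n : ℕ} {σ : C(Spx n, X)} {V : Set X} (hV : ∀ p, σ p ∈ V) :
    Sub (fun _ => V) σ :=
  fun _ _ _ p _ => hV p

/-- Every point is subordinate to every nesting. -/
theorem subordinate_point (η : Nesting X) (σ : C(Spx 1, X)) : Sub η.ctrl σ := by
  intro S l _ p _
  have hbary (T : Face 1) : σ (bary T) = σ p := congrArg σ (Subsingleton.elim _ _)
  simp only [hbary, List.map_const']
  have key (k : ℕ) : σ p ∈ η.ctrl (List.replicate k (σ p)) := by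
    induction k with
    | zero =>
      change σ p ∈ η.toFun []
      rw [η.nil]
      trivial
    | succ k ih => exact η.mem_cons _ _ ih
  exact key _

/-! ### Cones over subordinate simplices -/

theorem mass_bary {n : ℕ} {T : Face (n + 1)} (h : 0 ∈ T.1) : mass (bary T) = 0 := by
  refine Finset.sum_eq_zero fun i _ => max_eq_right (sub_nonpos.2 ?_)
  rw [bary_apply, bary_apply, if_pos h]
  split_ifs
  · exact le_rfl
  · positivity

theorem exists_pushFace {n : ℕ} {T : Face (n + 1)} (h : 0 ∉ T.1) : ∃ T', T = pushFace 0 T' := by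
  have e : T.1 = (Finset.univ.filter fun i : Fin n => i.succ ∈ T.1).map
      (Fin.succAboveEmb (0 : Fin (n + 1))) := by
    ext j
    induction j using Fin.cases with
    | zero => simp [h]
    | succ j => simp
  refine ⟨⟨Finset.univ.filter fun i : Fin n => i.succ ∈ T.1, ?_⟩, Subtype.ext e⟩
  rw [← Finset.map_nonempty, ← e]
  exact T.2

theorem exists_eq_coface {n : ℕ} {p : Spx (n + 1)} (h : p 0 = 0) : ∃ q, p = coface 0 q := by
  have hsum : ∑ i : Fin n, p i.succ = 1 := by
    have := stdSimplex.sum_eq_one p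
    rwa [Fin.sum_univ_succ, h, zero_add] at this
  let q : Spx n := ⟨fun i => p i.succ, fun i => stdSimplex.zero_le p _, hsum⟩
  refine ⟨q, stdSimplex.ext (funext fun j => ?_)⟩
  induction j using Fin.cases with
  | zero => exact h.trans (coface_apply_self 0 q).symm
  | succ j => exact (coface_apply_succAbove 0 q j).symm

theorem coneMap_coface_zero {N n : ℕ} (b : Spx N) (τ : C(Spx n, Spx N)) (p : Spx n) :
    coneMap b τ (coface 0 p) = τ p :=
  DFunLike.congr_fun (coneMap_comp_coface_zero b τ) p

/-- The barycenters of a chain of faces of a cone: first come barycenters of a chain of faces of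
the base, then copies of the apex. -/
theorem exists_map_coneMap {N n : ℕ} (b : Spx N) (τ : C(Spx n, Spx N))
    (l : List (Face (n + 1))) (hl : l.Pairwise (· ≤ ·)) :
    ∃ (l' : List (Face n)) (k : ℕ), l'.Pairwise (· ≤ ·) ∧ (∀ R ∈ l', pushFace 0 R ∈ l) ∧
      l.map (fun T => coneMap b τ (bary T)) =
        l'.map (fun T => τ (bary T)) ++ List.replicate k b := by
  induction l with
  | nil => exact ⟨[], 0, .nil, by simp, rfl⟩
  | cons T l ih =>
    rw [List.pairwise_cons] at hl
    by_cases h : 0 ∈ T.1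
    · refine ⟨[], l.length + 1, .nil, by simp, ?_⟩
      rw [List.map_nil, List.nil_append, List.eq_replicate_iff]
      refine ⟨by simp, fun x hx => ?_⟩
      obtain ⟨R, hR, rfl⟩ := List.mem_map.1 hx
      refine coneMap_of_mass_eq_zero b τ (mass_bary ?_)
      rcases List.mem_cons.1 hR with rfl | hR
      · exact h
      · exact hl.1 R hR h
    · obtain ⟨T, rfl⟩ := exists_pushFace h
      obtain ⟨l', k, h1, h2, h3⟩ := ih hl.2
      refine ⟨T :: l', k, List.pairwise_cons.2
        ⟨fun R hR => (pushFace_le 0).1 (hl.1 _ (h2 R hR)), h1⟩, ?_, ?_⟩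
      · intro R hR
        rcases List.mem_cons.1 hR with rfl | hR
        · exact List.mem_cons_self
        · exact List.mem_cons_of_mem _ (h2 R hR)
      · rw [List.map_cons, h3, List.map_cons, List.cons_append, ← coface_bary, coneMap_coface_zero]

/-- The cone with apex `b` over a simplex that is small for `l ↦ θ (l, b)` is small for `θ`, as soon
as it lies in `θ (b)`: all faces that contain the apex are tagged by `b`. -/
theorem Sub.coneMap {N n : ℕ} {θ : List (Spx N) → Set (Spx N)}
    (anti : ∀ {l l'}, Reindexes l l' → θ l ⊆ θ l') {b : Spx N} {τ : C(Spx n, Spx N)}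
    (hτ : Sub (shift θ [b]) τ) (hb : ∀ s, SmallChains.coneMap b τ s ∈ θ [b]) :
    Sub θ (SmallChains.coneMap b τ) := by
  intro S l hl p hp
  obtain ⟨l', k, h1, h2, h3⟩ := exists_map_coneMap b τ (S :: l) (List.isChain_iff_pairwise.1 hl)
  rw [h3]
  have hk : Reindexes [b] (List.replicate k b) := by
    simpa using Reindexes.replicate_append b [] k
  cases l' with
  | nil => exact anti hk (hb p)
  | cons R l' =>
    refine anti (hk.append_left _) ?_
    have hSR : S ≤ pushFace 0 R := by
      rcases List.mem_cons.1 (h2 R List.mem_cons_self) with h | h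
      · exact h.ge
      · exact (List.pairwise_cons.1 (List.isChain_iff_pairwise.1 hl)).1 _ h
    have hp' (i : Fin (n + 1)) (hi : i ∉ (pushFace 0 R).1) : p i = 0 := hp i fun h => hi (hSR h)
    obtain ⟨q, rfl⟩ : ∃ q, p = coface 0 q :=
      exists_eq_coface (hp' 0 (by simp [pushFace]))
    rw [coneMap_coface_zero]
    refine hτ R l' (List.isChain_iff_pairwise.2 h1) q fun i hi => ?_
    rw [← coface_apply_succAbove 0 q i]
    exact hp' _ (by simpa [pushFace] using hi)

end SmallChains

/-! ### Subordinate chains -/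

namespace SmallChains

section

variable {X : Type u} [TopologicalSpace X] {Y : Type v} [TopologicalSpace Y]

/-- The chains generated by the simplices that are subordinate to `θ`. -/
def chn (θ : List X → Set X) (n : ℕ) : AddSubgroup (Chains X n) :=
  AddSubgroup.closure {x | ∃ σ : C(Spx n, X), Sub θ σ ∧ x = FreeAbelianGroup.of σ}

theorem of_mem_chn {θ : List X → Set X} {n : ℕ} {σ : C(Spx n, X)} (h : Sub θ σ) :
    FreeAbelianGroup.of σ ∈ chn θ n :=
  AddSubgroup.subset_closure ⟨σ, h, rfl⟩

theorem map_mem_of_chn {G : Type*} [AddCommGroup G] {θ : List X → Set X} {n : ℕ}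
    (f : Chains X n →+ G) (S : AddSubgroup G)
    (h : ∀ σ : C(Spx n, X), Sub θ σ → f (FreeAbelianGroup.of σ) ∈ S) {x : Chains X n}
    (hx : x ∈ chn θ n) : f x ∈ S := by
  suffices chn θ n ≤ S.comap f from this hx
  rw [chn, AddSubgroup.closure_le]
  rintro _ ⟨σ, hσ, rfl⟩
  exact h σ hσ

theorem map_mem {G : Type*} [AddCommGroup G] {n : ℕ} (f : Chains X n →+ G) (S : AddSubgroup G)
    (h : ∀ σ : C(Spx n, X), f (FreeAbelianGroup.of σ) ∈ S) (x : Chains X n) : f x ∈ S := by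
  induction x using FreeAbelianGroup.induction_on with
  | zero => simp
  | of σ => exact h σ
  | neg x hx =>
    rw [map_neg]
    exact neg_mem hx
  | add x y hx hy =>
    rw [map_add]
    exact add_mem hx hy

theorem chn_mono {θ θ' : List X → Set X} {n : ℕ}
    (h : ∀ σ : C(Spx n, X), Sub θ σ → Sub θ' σ) : chn θ n ≤ chn θ' n :=
  fun _ hx => map_mem_of_chn (AddMonoidHom.id _) (chn θ' n) (fun σ hσ => of_mem_chn (h σ hσ)) hx

theorem push_mem_chn {θ : List Y → Set Y} {n : ℕ} (f : C(X, Y)) {x : Chains X n}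
    (hx : x ∈ chn (pull f θ) n) : push f x ∈ chn θ n :=
  map_mem_of_chn (push f) _
    (fun σ hσ => by
      rw [push_of]
      exact of_mem_chn (sub_comp.2 hσ)) hx

theorem bd_mem_chn {θ : List X → Set X} {n : ℕ} {x : Chains X (n + 1)}
    (hx : x ∈ chn θ (n + 1)) : bd n x ∈ chn θ n :=
  map_mem_of_chn (bd n) _
    (fun σ hσ => by
      rw [bd_of]
      exact sum_mem fun i _ => zsmul_mem (of_mem_chn (hσ.face i)) _) hx

theorem cone_mem_chn {N n : ℕ} {θ : List (Spx N) → Set (Spx N)}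
    (anti : ∀ {l l'}, Reindexes l l' → θ l ⊆ θ l') {V : Set (Spx N)} (hV : IsConvex V)
    {b : Spx N} (hb : b ∈ V) (hVθ : V ⊆ θ [b]) {x : Chains (Spx N) n}
    (hx : x ∈ chn (fun l => shift θ [b] l ∩ V) n) : cone b x ∈ chn θ (n + 1) := by
  cases n with
  | zero =>
    refine map_mem (cone b) _ (fun σ => ?_) x
    rw [cone_of]
    refine of_mem_chn (Sub.coneMap anti (subordinate_empty _ _) fun s => hVθ ?_)
    exact coneMap_mem hV hb (fun p => absurd p.2 (by simp [stdSimplex_of_isEmpty_index])) s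
  | succ n =>
    refine map_mem_of_chn (cone b) _ (fun σ hσ => ?_) hx
    rw [cone_of]
    refine of_mem_chn (Sub.coneMap anti (hσ.mono fun l _ _ => Set.inter_subset_left) fun s => hVθ ?_)
    exact coneMap_mem hV hb (fun p => (hσ.apply_mem p).2) s

/-! ### Chain maps given by universal chains -/

/-- The natural map sending a simplex `σ` to the image under `σ` of the chain `a (σ⁻¹ θ)` of the
standard simplex. -/
noncomputable def extend {m r : ℕ} (a : (List (Spx m) → Set (Spx m)) → Chains (Spx m) r)
    (θ : List X → Set X) : Chains X m →+ Chains X r :=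
  FreeAbelianGroup.lift fun σ => push σ (a (pull σ θ))

theorem extend_of {m r : ℕ} (a : (List (Spx m) → Set (Spx m)) → Chains (Spx m) r)
    (θ : List X → Set X) (σ : C(Spx m, X)) :
    extend a θ (FreeAbelianGroup.of σ) = push σ (a (pull σ θ)) :=
  FreeAbelianGroup.lift_apply_of _ _

theorem extend_push {m r : ℕ} (a : (List (Spx m) → Set (Spx m)) → Chains (Spx m) r)
    (θ : List Y → Set Y) (f : C(X, Y)) (x : Chains X m) :
    extend a θ (push f x) = push f (extend a (pull f θ) x) := by
  induction x using FreeAbelianGroup.induction_on with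
  | zero => simp
  | of σ =>
    rw [push_of, extend_of, extend_of, push_push, pull_pull]
    rfl
  | neg x hx => simp only [map_neg, hx]
  | add x y hx hy => simp only [map_add, hx, hy]

end

/-- The identity of the standard simplex, as a singular simplex. -/
abbrev idSpx (m : ℕ) : C(Spx m, Spx m) := ContinuousMap.id _

theorem extend_bd_idSpx {X : Type u} [TopologicalSpace X] {m r : ℕ}
    (a : (List (Spx m) → Set (Spx m)) → Chains (Spx m) r)
    (θ : List X → Set X) (σ : C(Spx (m + 1), X)) :
    push σ (extend a (pull σ θ) (bd m (FreeAbelianGroup.of (idSpx (m + 1))))) =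
      extend a θ (bd m (FreeAbelianGroup.of σ)) := by
  rw [← extend_push, ← bd_push, push_of, ContinuousMap.comp_id]

open Classical in
/-- The universal `θ`-small approximation of the standard simplex: a chain subordinate to `θ` whose
boundary is the sum of the approximations of the faces, if there is one. It is chosen to be the
identity whenever the identity is subordinate to `θ`. -/
noncomputable def approx (m : ℕ) : (List (Spx m) → Set (Spx m)) → Chains (Spx m) m :=
  match m with
  | 0 => fun _ => FreeAbelianGroup.of (idSpx 0)
  | m + 1 => fun θ =>
    if h : ∃ y ∈ chn θ (m + 1),
        bd m y = extend (approx m) θ (bd m (FreeAbelianGroup.of (idSpx (m + 1)))) ∧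
        (Sub θ (idSpx (m + 1)) → y = FreeAbelianGroup.of (idSpx (m + 1)))
    then h.choose else 0

/-- The universal homotopy from the identity to `approx`, by coning from the barycenter. -/
noncomputable def homotopy (m : ℕ) : (List (Spx m) → Set (Spx m)) → Chains (Spx m) (m + 1) :=
  match m with
  | 0 => fun _ => 0
  | m + 1 => fun θ => cone (center m) (FreeAbelianGroup.of (idSpx (m + 1)) - approx (m + 1) θ -
      extend (homotopy m) θ (bd m (FreeAbelianGroup.of (idSpx (m + 1)))))

/-- `approx` has its defining properties for simplices with at most `n` vertices. -/
structure Valid (n : ℕ) : Prop where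
  mem : ∀ m ≤ n, ∀ η : Nesting (Spx m), approx m η.ctrl ∈ chn η.ctrl m
  eq_of : ∀ m ≤ n, ∀ η : Nesting (Spx m), Sub η.ctrl (idSpx m) →
    approx m η.ctrl = FreeAbelianGroup.of (idSpx m)
  bd_eq : ∀ m < n, ∀ η : Nesting (Spx (m + 1)), bd m (approx (m + 1) η.ctrl) =
    extend (approx m) η.ctrl (bd m (FreeAbelianGroup.of (idSpx (m + 1))))

namespace Valid

variable {X : Type u} [TopologicalSpace X] {n : ℕ} (hn : Valid n) (η : Nesting X)
include hn

theorem extend_mem {m : ℕ} (hm : m ≤ n) (x : Chains X m) :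
    extend (approx m) η.ctrl x ∈ chn η.ctrl m :=
  map_mem _ _ (fun σ => by
    rw [extend_of]
    exact push_mem_chn σ (hn.mem m hm (η.comap σ))) x

theorem extend_mem_inter {m : ℕ} (hm : m ≤ n) {V : Set X} {x : Chains X m}
    (hx : x ∈ chn (fun _ => V) m) :
    extend (approx m) η.ctrl x ∈ chn (fun l => η.ctrl l ∩ V) m := by
  cases m with
  | zero =>
    refine chn_mono (fun σ _ => subordinate_empty _ σ) (hn.extend_mem η hm x)
  | succ m =>
    refine map_mem_of_chn _ _ (fun σ hσ => ?_) hx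
    rw [extend_of]
    refine push_mem_chn σ (chn_mono (fun τ hτ => ?_) (hn.mem _ hm (η.comap σ)))
    exact hτ.inter fun p => hσ.apply_mem (τ p)

theorem extend_eq_self {m : ℕ} (hm : m ≤ n) {x : Chains X m} (hx : x ∈ chn η.ctrl m) :
    extend (approx m) η.ctrl x = x := by
  rw [← sub_eq_zero]
  refine map_mem_of_chn (extend (approx m) η.ctrl - AddMonoidHom.id _) ⊥ (fun σ hσ => ?_) hx
  have h : approx m (pull σ η.ctrl) = FreeAbelianGroup.of (idSpx m) :=
    hn.eq_of m hm (η.comap σ)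
      (sub_comp (θ := η.ctrl) (f := σ).1 (by rwa [ContinuousMap.comp_id]))
  simp [extend_of, h]

theorem bd_extend {m : ℕ} (hm : m < n) (x : Chains X (m + 1)) :
    bd m (extend (approx (m + 1)) η.ctrl x) = extend (approx m) η.ctrl (bd m x) := by
  induction x using FreeAbelianGroup.induction_on with
  | zero => simp
  | of σ =>
    rw [extend_of, bd_push, ← extend_bd_idSpx]
    exact congrArg _ (hn.bd_eq m hm (η.comap σ))
  | neg x hx => simp only [map_neg, hx]
  | add x y hx hy => simp only [map_add, hx, hy]

omit hn in
theorem extend_zero (x : Chains X 0) : extend (approx 0) η.ctrl x = x := by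
  rw [← sub_eq_zero]
  refine map_mem (extend (approx 0) η.ctrl - AddMonoidHom.id _) ⊥ (fun σ => ?_) x
  simp [extend_of, approx]

omit hn in
theorem homotopy_zero (x : Chains X 0) : extend (homotopy 0) η.ctrl x = 0 :=
  map_mem (extend (homotopy 0) η.ctrl) ⊥ (fun σ => by simp [extend_of, homotopy]) x

omit hn in
theorem bd_homotopy_of_bd_eq {m : ℕ}
    (h : ∀ η : Nesting (Spx (m + 1)), bd (m + 1) (homotopy (m + 1) η.ctrl) =
      FreeAbelianGroup.of (idSpx (m + 1)) - approx (m + 1) η.ctrl -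
        extend (homotopy m) η.ctrl (bd m (FreeAbelianGroup.of (idSpx (m + 1)))))
    (x : Chains X (m + 1)) :
    bd (m + 1) (extend (homotopy (m + 1)) η.ctrl x) = x - extend (approx (m + 1)) η.ctrl x -
      extend (homotopy m) η.ctrl (bd m x) := by
  induction x using FreeAbelianGroup.induction_on with
  | zero => simp
  | of σ =>
    rw [extend_of, bd_push]
    refine (congrArg (push σ) (h (η.comap σ))).trans ?_
    rw [map_sub, map_sub, push_of, ContinuousMap.comp_id, extend_of,
      ← extend_bd_idSpx (homotopy m) η.ctrl σ]
    rfl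
  | neg x hx =>
    simp only [map_neg, hx]
    abel
  | add x y hx hy =>
    simp only [map_add, hx, hy]
    abel

omit η in
theorem bd_homotopy_spx {m : ℕ} (hm : m < n) (η : Nesting (Spx (m + 1))) :
    bd (m + 1) (homotopy (m + 1) η.ctrl) =
      FreeAbelianGroup.of (idSpx (m + 1)) - approx (m + 1) η.ctrl -
        extend (homotopy m) η.ctrl (bd m (FreeAbelianGroup.of (idSpx (m + 1)))) := by
  induction m with
  | zero =>
    refine (bd_cone (center 0) _).trans (sub_eq_self.2 ((congrArg _ ?_).trans (map_zero _)))
    rw [map_sub, map_sub, hn.bd_eq 0 hm, extend_zero, homotopy_zero]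
    simp
  | succ m ih =>
    refine (bd_cone (center (m + 1)) _).trans (sub_eq_self.2 ((congrArg _ ?_).trans (map_zero _)))
    rw [map_sub, map_sub, hn.bd_eq (m + 1) hm,
      bd_homotopy_of_bd_eq η (ih (Nat.lt_of_succ_lt hm)), bd_bd]
    simp

/-- `extend homotopy` is a chain homotopy from the identity to `extend approx`. -/
theorem bd_homotopy {m : ℕ} (hm : m < n) (x : Chains X (m + 1)) :
    bd (m + 1) (extend (homotopy (m + 1)) η.ctrl x) = x - extend (approx (m + 1)) η.ctrl x -
      extend (homotopy m) η.ctrl (bd m x) :=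
  bd_homotopy_of_bd_eq η (hn.bd_homotopy_spx hm) x

end Valid

end SmallChains

namespace SmallChains

/-! ### The homotopy preserves subordinate chains -/

section

variable {X : Type u} [TopologicalSpace X]

/-- Once `ζ` is fine enough, `homotopy` preserves subordination to `η`: the cones with apex the
barycenter `b` of `σ` are tagged by `b`, and on `σ`, `ζ` refines `l ↦ η (l, b)`. -/
theorem Valid.eventually_homotopy_mem {n : ℕ} (hn : Valid n) (η : Nesting X) {m : ℕ} (hm : m ≤ n)
    (L : List X) (σ : C(Spx m, X)) (hσ : Sub (shift η.ctrl L) σ) :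
    ∀ᶠ ζ : Nesting X in Filter.atBot,
      homotopy m (pull σ ζ.ctrl) ∈ chn (pull σ (shift η.ctrl L)) (m + 1) := by
  induction m generalizing L with
  | zero => exact Filter.Eventually.of_forall fun ζ => zero_mem _
  | succ m ih =>
    have hσ' : Sub (shift η.ctrl (σ (center m) :: L)) σ := by
      have h := hσ.shift_center
      rwa [shift_shift] at h
    have hfaces := Filter.eventually_all.2 fun i : Fin (m + 1) =>
      ih (Nat.le_of_succ_le hm) (σ (center m) :: L) (σ.comp (coface i)) (hσ'.face i)
    filter_upwards [hfaces, η.eventually_adapted (σ (center m) :: L)] with ζ hζ had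
    have hθ : shift (pull σ (shift η.ctrl L)) [center m] =
        pull σ (shift η.ctrl (σ (center m) :: L)) := by
      rw [← pull_shift, shift_shift]
      rfl
    have anti {l l' : List (Spx (m + 1))} (h : Reindexes l l') :
        pull σ (shift η.ctrl L) l ⊆ pull σ (shift η.ctrl L) l' :=
      fun p hp => η.antitone ((h.map σ).append_right L) hp
    have huniv : Set.univ ⊆ pull σ (shift η.ctrl L) [center m] := fun p _ => hσ.apply_mem p
    refine cone_mem_chn anti (fun _ _ _ _ _ _ => Set.mem_univ _) (Set.mem_univ (center m)) huniv ?_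
    simp only [Set.inter_univ]
    change _ ∈ chn (shift (pull σ (shift η.ctrl L)) [center m]) (m + 1)
    rw [hθ]
    refine sub_mem (sub_mem ?_ ?_) ?_
    · exact of_mem_chn (sub_comp (f := σ).1 hσ')
    · refine chn_mono (fun τ hτ => ?_) (hn.mem (m + 1) hm (ζ.comap σ))
      refine hτ.mono fun l hl _ p hp => had (l.map σ) (by simpa using hl) ?_ hp
      intro x hx
      obtain ⟨q, -, rfl⟩ := List.mem_map.1 hx
      exact hσ.apply_mem q
    · simp only [bd_of, map_sum, map_zsmul, extend_of]
      refine sum_mem fun i _ => zsmul_mem (push_mem_chn _ ?_) _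
      rw [pull_pull, pull_pull]
      exact hζ i

theorem Valid.eventually_extend_homotopy_mem {n : ℕ} (hn : Valid n) (η : Nesting X) {m : ℕ}
    (hm : m ≤ n) {x : Chains X m} (hx : x ∈ chn η.ctrl m) :
    ∀ᶠ ζ : Nesting X in Filter.atBot, extend (homotopy m) ζ.ctrl x ∈ chn η.ctrl (m + 1) := by
  induction hx using AddSubgroup.closure_induction with
  | mem x hx =>
    obtain ⟨σ, hσ, rfl⟩ := hx
    have h := hn.eventually_homotopy_mem η hm [] σ (by rwa [shift_nil])
    filter_upwards [h] with ζ hζ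
    rw [extend_of]
    rw [shift_nil] at hζ
    exact push_mem_chn σ hζ
  | zero => simp
  | add x y _ _ hx hy =>
    filter_upwards [hx, hy] with ζ hx hy
    rw [map_add]
    exact add_mem hx hy
  | neg x _ hx =>
    filter_upwards [hx] with ζ hx
    rw [map_neg]
    exact neg_mem hx

/-- A subordinate cycle is homologous, through subordinate chains, to its approximations by finer
cycles. -/
theorem Valid.eventually_exists_bd_eq_sub {n : ℕ} (hn : Valid (n + 1)) (η : Nesting X)
    {x : Chains X (n + 1)} (hx : x ∈ chn η.ctrl (n + 1)) (hx0 : bd n x = 0) :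
    ∀ᶠ ζ : Nesting X in Filter.atBot, ∃ y ∈ chn η.ctrl (n + 2),
      bd (n + 1) y = x - extend (approx (n + 1)) ζ.ctrl x := by
  filter_upwards [hn.eventually_extend_homotopy_mem η le_rfl hx] with ζ hζ
  refine ⟨_, hζ, ?_⟩
  rw [hn.bd_homotopy ζ (Nat.lt_succ_self n), hx0, map_zero, sub_zero]

end

/-! ### Filling fine chains -/

/-- The chains generated by simplices each of which lies in a convex subset of some `η (t)` that
contains `t`. -/
def fine {N : ℕ} (η : Nesting (Spx N)) (n : ℕ) : AddSubgroup (Chains (Spx N) n) :=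
  AddSubgroup.closure {x | ∃ (V : Set (Spx N)) (t : Spx N) (σ : C(Spx n, Spx N)),
    IsConvex V ∧ t ∈ V ∧ V ⊆ η.ctrl [t] ∧ (∀ p, σ p ∈ V) ∧ x = FreeAbelianGroup.of σ}

/-- The approximated boundary of a simplex in a convex set `V ⊆ η (t)` bounds a subordinate chain:
the cone with apex `t`. -/
theorem Valid.eventually_exists_bd_eq_extend {n N : ℕ} (hn : Valid (n + 1)) (η : Nesting (Spx N))
    {y : Chains (Spx N) (n + 2)} (hy : y ∈ fine η (n + 2)) :
    ∀ᶠ ζ : Nesting (Spx N) in Filter.atBot, ∃ w ∈ chn η.ctrl (n + 2),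
      bd (n + 1) w = extend (approx (n + 1)) ζ.ctrl (bd (n + 1) y) := by
  induction hy using AddSubgroup.closure_induction with
  | mem x hx =>
    obtain ⟨V, t, σ, hV, ht, hVη, hσ, rfl⟩ := hx
    filter_upwards [η.eventually_adapted [t]] with ζ hζ
    refine ⟨cone t (extend (approx (n + 1)) ζ.ctrl (bd (n + 1) (FreeAbelianGroup.of σ))), ?_, ?_⟩
    · refine cone_mem_chn (fun h => η.antitone h) hV ht hVη (chn_mono (fun τ hτ => ?_)
        (hn.extend_mem_inter ζ le_rfl (bd_mem_chn (of_mem_chn (sub_const hσ)))))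
      refine hτ.mono fun l hl hlτ p hp => ⟨hζ l hl (fun x hx => ?_) hp.1, hp.2⟩
      obtain ⟨q, rfl⟩ := hlτ x hx
      exact hVη (hτ.apply_mem q).2
    · rw [bd_cone, hn.bd_extend ζ (Nat.lt_succ_self n), bd_bd, map_zero, map_zero, sub_zero]
  | zero => exact Filter.Eventually.of_forall fun ζ => ⟨0, zero_mem _, by simp⟩
  | add x y _ _ hx hy =>
    filter_upwards [hx, hy] with ζ ⟨w, hw, hx⟩ ⟨w', hw', hy⟩
    exact ⟨w + w', add_mem hw hw', by simp only [map_add, hx, hy]⟩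
  | neg x _ hx =>
    filter_upwards [hx] with ζ ⟨w, hw, hx⟩
    exact ⟨-w, neg_mem hw, by simp only [map_neg, hx]⟩

/-! ### Small cycles bound fine chains -/

section

variable {X : Type u} [TopologicalSpace X] {N : ℕ}

/-- The chain homotopy given by the segments from `f x` to `g x`. -/
noncomputable def prism (f g : C(X, Spx N)) (n : ℕ) : Chains X n →+ Chains (Spx N) (n + 1) :=
  match n with
  | 0 => 0
  | n + 1 => FreeAbelianGroup.lift fun σ => cone (f (σ (center n)))
      (push f (FreeAbelianGroup.of σ) - push g (FreeAbelianGroup.of σ) -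
        prism f g n (bd n (FreeAbelianGroup.of σ)))

theorem prism_of (f g : C(X, Spx N)) {n : ℕ} (σ : C(Spx (n + 1), X)) :
    prism f g (n + 1) (FreeAbelianGroup.of σ) = cone (f (σ (center n)))
      (push f (FreeAbelianGroup.of σ) - push g (FreeAbelianGroup.of σ) -
        prism f g n (bd n (FreeAbelianGroup.of σ))) :=
  FreeAbelianGroup.lift_apply_of _ _

theorem push_eq_push (f g : C(X, Spx N)) (x : Chains X 0) : push f x = push g x := by
  rw [← sub_eq_zero]
  refine map_mem (push f - push g) ⊥ (fun σ => ?_) x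
  have : f.comp σ = g.comp σ :=
    ContinuousMap.ext fun p => absurd p.2 (by simp [stdSimplex_of_isEmpty_index])
  simp [this]

theorem bd_prism (f g : C(X, Spx N)) {n : ℕ} (x : Chains X (n + 1)) :
    bd (n + 1) (prism f g (n + 1) x) = push f x - push g x - prism f g n (bd n x) := by
  induction n with
  | zero =>
    induction x using FreeAbelianGroup.induction_on with
    | zero => simp
    | of σ =>
      rw [prism_of, bd_cone]
      refine sub_eq_self.2 ((congrArg _ ?_).trans (map_zero _))
      rw [map_sub, map_sub, bd_push, bd_push, push_eq_push f g]
      simp [prism]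
    | neg x hx =>
      simp only [map_neg, hx]
      abel
    | add x y hx hy =>
      simp only [map_add, hx, hy]
      abel
  | succ n ih =>
    induction x using FreeAbelianGroup.induction_on with
    | zero => simp
    | of σ =>
      rw [prism_of, bd_cone]
      refine sub_eq_self.2 ((congrArg _ ?_).trans (map_zero _))
      rw [map_sub, map_sub, bd_push, bd_push, ih, bd_bd]
      simp
    | neg x hx =>
      simp only [map_neg, hx]
      abel
    | add x y hx hy =>
      simp only [map_add, hx, hy]
      abel

theorem cone_mem_chn_const {V : Set (Spx N)} (hV : IsConvex V) {b : Spx N} (hb : b ∈ V) {n : ℕ}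
    {x : Chains (Spx N) n} (hx : x ∈ chn (fun _ => V) n) : cone b x ∈ chn (fun _ => V) (n + 1) := by
  refine cone_mem_chn (fun _ => subset_rfl) hV hb subset_rfl ?_
  simpa only [shift, Set.inter_self] using hx

theorem prism_mem {V : Set (Spx N)} (hV : IsConvex V) (f g : C(X, Spx N)) {n : ℕ} {x : Chains X n}
    (hx : x ∈ chn (fun _ => f ⁻¹' V ∩ g ⁻¹' V) n) : prism f g n x ∈ chn (fun _ => V) (n + 1) := by
  induction n with
  | zero => exact zero_mem _
  | succ n ih =>
    refine map_mem_of_chn _ _ (fun σ hσ => ?_) hx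
    rw [prism_of]
    refine cone_mem_chn_const hV (hσ.apply_mem _).1 (sub_mem (sub_mem ?_ ?_) ?_)
    · rw [push_of]
      exact of_mem_chn (sub_const fun p => (hσ.apply_mem p).1)
    · rw [push_of]
      exact of_mem_chn (sub_const fun p => (hσ.apply_mem p).2)
    · exact ih (bd_mem_chn (of_mem_chn hσ))

theorem chn_const_le_fine {η : Nesting (Spx N)} {V : Set (Spx N)} (hV : IsConvex V) {t : Spx N}
    (ht : t ∈ V) (hVη : V ⊆ η.ctrl [t]) (n : ℕ) : chn (fun _ => V) (n + 1) ≤ fine η (n + 1) := by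
  rw [chn, AddSubgroup.closure_le]
  rintro _ ⟨σ, hσ, rfl⟩
  exact AddSubgroup.subset_closure ⟨V, t, σ, hV, ht, hVη, fun p => hσ.apply_mem p, rfl⟩

end

theorem isConvex_ball {N : ℕ} (t : Spx N) (r : ℝ) : IsConvex (Metric.ball t r) :=
  fun _ hb _ hy s hs => convex_ball t.1 r hb hy (sub_nonneg.2 hs.2) hs.1 (sub_add_cancel 1 s)

theorem lin_self {N : ℕ} (c : Spx N) (t : ℝ) (ht : t ∈ Set.Icc (0 : ℝ) 1) : lin c c t ht = c := by
  apply Subtype.ext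
  change (1 - t) • c.1 + t • c.1 = c.1
  rw [← add_smul, sub_add_cancel, one_smul]

theorem mem_ctrl_singleton {X : Type u} [TopologicalSpace X] (η : Nesting X) (x : X) :
    x ∈ η.ctrl [x] :=
  η.mem_cons x [] (by rw [η.nil]; trivial)

/-- The contraction of the standard simplex to the point `c` along segments, at time `t`. -/
noncomputable def contraction {N : ℕ} (c : Spx N) (t : ℝ) (ht : t ∈ Set.Icc (0 : ℝ) 1) :
    C(Spx N, Spx N) :=
  ⟨fun p => lin p c t ht, Continuous.subtype_mk
    ((continuous_subtype_val.const_smul (1 - t)).add continuous_const) _⟩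

theorem dist_contraction_le {N : ℕ} (c p q : Spx N) {s t : ℝ} (hs : s ∈ Set.Icc (0 : ℝ) 1)
    (ht : t ∈ Set.Icc (0 : ℝ) 1) :
    dist (contraction c s hs p) (contraction c t ht q) ≤ dist p q + abs (s - t) := by
  refine (dist_pi_le_iff (by positivity)).2 fun i => ?_
  have hpq : abs (p i - q i) ≤ dist p q := dist_le_pi_dist p.1 q.1 i
  change abs (((1 - s) * p i + s * c i) - ((1 - t) * q i + t * c i)) ≤ _
  have e : ((1 - s) * p i + s * c i) - ((1 - t) * q i + t * c i) =
    (1 - s) * (p i - q i) + (s - t) * (c i - q i) := by ring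
  rw [e]
  refine (abs_add_le _ _).trans (add_le_add ?_ ?_)
  · rw [abs_mul, abs_of_nonneg (sub_nonneg.2 hs.2)]
    exact (mul_le_of_le_one_left (abs_nonneg _) (sub_le_self 1 hs.1)).trans hpq
  · rw [abs_mul]
    refine mul_le_of_le_one_right (abs_nonneg _) (abs_le.2 ?_)
    have h1 := stdSimplex.zero_le c i
    have h2 := stdSimplex.le_one c i
    have h3 := stdSimplex.zero_le q i
    have h4 := stdSimplex.le_one q i
    constructor <;> linarith

/-- A cycle of sufficiently small simplices bounds a fine chain: contract it to a point in small
steps. Each step moves a small simplex inside a small ball. -/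
theorem exists_fine {N n : ℕ} (η : Nesting (Spx (N + 1))) : ∃ ζ : Nesting (Spx (N + 1)),
    ∀ x ∈ chn ζ.ctrl (n + 1), bd n x = 0 → ∃ y ∈ fine η (n + 2), bd (n + 1) y = x := by
  have hball (t : Spx (N + 1)) : ∃ r > 0, Metric.ball t r ⊆ η.ctrl [t] :=
    Metric.isOpen_iff.1 (η.toFun [t]).isOpen t (mem_ctrl_singleton η t)
  choose r hr hrη using hball
  obtain ⟨δ, hδ, hL⟩ := lebesgue_number_lemma_of_metric (isCompact_univ (X := Spx (N + 1)))
    (fun t => Metric.isOpen_ball (x := t) (ε := r t))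
    fun t _ => Set.mem_iUnion.2 ⟨t, Metric.mem_ball_self (hr t)⟩
  obtain ⟨M, hM⟩ := exists_nat_gt (2 / δ)
  have hM0 : (0 : ℝ) < M := (by positivity : (0 : ℝ) < 2 / δ).trans hM
  let c : Spx (N + 1) := center N
  let T (i : ℕ) : ℝ := min (i / M) 1
  have hT (i : ℕ) : T i ∈ Set.Icc (0 : ℝ) 1 := ⟨by positivity, min_le_right _ _⟩
  have hTT (i : ℕ) : abs (T i - T (i + 1)) < δ / 2 := by
    have h : abs (T i - T (i + 1)) ≤ 1 / M := by
      refine (abs_min_sub_min_le_max _ _ _ _).trans ?_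
      rw [sub_self, abs_zero, max_eq_left (abs_nonneg _), ← sub_div]
      push_cast
      rw [sub_add_cancel_left, abs_div, abs_neg, abs_one, abs_of_pos hM0]
    refine h.trans_lt ?_
    rw [div_lt_iff₀ hδ] at hM
    rw [div_lt_iff₀ hM0]
    linarith
  let h (i : ℕ) : C(Spx (N + 1), Spx (N + 1)) := contraction c (T i) (hT i)
  have h0 : h 0 = ContinuousMap.id _ := by
    ext1 p
    apply Subtype.ext
    change (1 - T 0) • p.1 + T 0 • c.1 = p.1
    simp [T]
  have hend (p : Spx (N + 1)) : h M p = c := by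
    apply Subtype.ext
    change (1 - T M) • p.1 + T M • c.1 = c.1
    simp [T, div_self hM0.ne']
  refine ⟨Nesting.ofNhds (fun x => ⟨Metric.ball x (δ / 2), Metric.isOpen_ball⟩)
    fun x => Metric.mem_ball_self (half_pos hδ), fun x hx hx0 => ?_⟩
  refine ⟨∑ i ∈ Finset.range M, prism (h i) (h (i + 1)) (n + 1) x + cone c (push (h M) x), ?_, ?_⟩
  · refine add_mem (sum_mem fun i _ => ?_) ?_
    · refine map_mem_of_chn _ _ (fun σ hσ => ?_) hx
      obtain ⟨t, ht⟩ := hL (h i (σ (center n))) trivial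
      refine chn_const_le_fine (isConvex_ball t (r t)) (Metric.mem_ball_self (hr t)) (hrη t) _
        (prism_mem (isConvex_ball t (r t)) _ _ (of_mem_chn (sub_const fun p => ?_)))
      have hp : dist (σ p) (σ (center n)) < δ / 2 := (hσ.apply_mem p).1
      have hii := hTT i
      constructor
      · refine ht ((dist_contraction_le c _ _ (hT i) (hT i)).trans_lt ?_)
        rw [sub_self, abs_zero, add_zero]
        linarith
      · refine ht ((dist_contraction_le c _ _ (hT (i + 1)) (hT i)).trans_lt ?_)
        rw [abs_sub_comm]
        linarith
    · have hV : IsConvex ({c} : Set (Spx (N + 1))) := by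
        rintro _ rfl _ rfl t ht
        exact lin_self c t ht
      refine chn_const_le_fine hV rfl (Set.singleton_subset_iff.2 (mem_ctrl_singleton η c)) _
        (cone_mem_chn_const hV rfl ?_)
      refine map_mem (push (h M)) _ (fun σ => ?_) x
      rw [push_of]
      exact of_mem_chn (sub_const fun p => hend (σ p))
  · have hprism (i : ℕ) : bd (n + 1) (prism (h i) (h (i + 1)) (n + 1) x) =
        push (h i) x - push (h (i + 1)) x := by
      rw [bd_prism, hx0, map_zero, sub_zero]
    have hid : push (h 0) x = x := by
      rw [h0]
      exact FreeAbelianGroup.map_id_apply x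
    rw [map_add, map_sum, Finset.sum_congr rfl fun i _ => hprism i,
      Finset.sum_range_sub' fun i => push (h i) x, bd_cone, bd_push, hx0, map_zero, map_zero,
      sub_zero, hid, sub_add_cancel]

/-! ### Acyclicity -/

/-- Subordinate cycles on simplices with `n + 1` vertices in a nonempty standard simplex bound
subordinate chains. -/
def Acyclic (n : ℕ) : Prop :=
  ∀ (N : ℕ) (η : Nesting (Spx (N + 1))), ∀ x ∈ chn η.ctrl (n + 1), bd n x = 0 →
    ∃ y ∈ chn η.ctrl (n + 2), bd (n + 1) y = x

theorem Valid.acyclic {n : ℕ} (hn : Valid (n + 1)) : Acyclic n := by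
  intro N η x hx hx0
  obtain ⟨ζ', hζ'⟩ := exists_fine (n := n) η
  obtain ⟨ζ, ⟨y, hy, hyx⟩, hζη, hζζ'⟩ := ((hn.eventually_exists_bd_eq_sub η hx hx0).and
    ((Filter.eventually_le_atBot η).and (Filter.eventually_le_atBot ζ'))).exists
  have hmem := hn.extend_mem ζ le_rfl x
  have hmem_of_le {ξ : Nesting (Spx (N + 1))} (h : ζ ≤ ξ) :
      extend (approx (n + 1)) ζ.ctrl x ∈ chn ξ.ctrl (n + 1) :=
    chn_mono (fun σ hσ => hσ.mono fun l _ _ => Nesting.ctrl_subset h l) hmem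
  have hcycle : bd n (extend (approx (n + 1)) ζ.ctrl x) = 0 := by
    rw [hn.bd_extend ζ (Nat.lt_succ_self n), hx0, map_zero]
  obtain ⟨z, hz, hzx⟩ := hζ' _ (hmem_of_le hζζ') hcycle
  obtain ⟨ξ, ⟨y', hy', hyx'⟩, w, hw, hwx⟩ :=
    ((hn.eventually_exists_bd_eq_sub η (hmem_of_le hζη) hcycle).and
      (hn.eventually_exists_bd_eq_extend η hz)).exists
  refine ⟨y + y' + w, add_mem (add_mem hy hy') hw, ?_⟩
  rw [map_add, map_add, hyx, hyx', hwx, hzx]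
  abel

theorem valid_zero : Valid 0 where
  mem m hm η := by
    obtain rfl := Nat.le_zero.1 hm
    exact of_mem_chn (subordinate_empty _ _)
  eq_of m hm η _ := by
    obtain rfl := Nat.le_zero.1 hm
    rfl
  bd_eq m hm := absurd hm (Nat.not_lt_zero m)

theorem Valid.exists_approx {n : ℕ} (hn : Valid n) (hA : ∀ j, n = j + 1 → Acyclic j)
    (η : Nesting (Spx (n + 1))) : ∃ y ∈ chn η.ctrl (n + 1),
      bd n y = extend (approx n) η.ctrl (bd n (FreeAbelianGroup.of (idSpx (n + 1)))) ∧
      (Sub η.ctrl (idSpx (n + 1)) → y = FreeAbelianGroup.of (idSpx (n + 1))) := by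
  by_cases h : Sub η.ctrl (idSpx (n + 1))
  · exact ⟨_, of_mem_chn h, (hn.extend_eq_self η le_rfl (bd_mem_chn (of_mem_chn h))).symm,
      fun _ => rfl⟩
  · cases n with
    | zero => exact absurd (subordinate_point η _) h
    | succ n =>
      obtain ⟨y, hy, hyb⟩ := hA n rfl (n + 1) η _
        (hn.extend_mem η le_rfl (bd (n + 1) (FreeAbelianGroup.of (idSpx (n + 2)))))
        (by rw [hn.bd_extend η (Nat.lt_succ_self n), bd_bd, map_zero])
      exact ⟨y, hy, hyb, fun h' => absurd h' h⟩

theorem Valid.succ {n : ℕ} (hn : Valid n) (hA : ∀ j, n = j + 1 → Acyclic j) : Valid (n + 1) := by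
  have key (η : Nesting (Spx (n + 1))) :
      approx (n + 1) η.ctrl ∈ chn η.ctrl (n + 1) ∧ bd n (approx (n + 1) η.ctrl) =
        extend (approx n) η.ctrl (bd n (FreeAbelianGroup.of (idSpx (n + 1)))) ∧
      (Sub η.ctrl (idSpx (n + 1)) →
        approx (n + 1) η.ctrl = FreeAbelianGroup.of (idSpx (n + 1))) := by
    have h := hn.exists_approx hA η
    have e : approx (n + 1) η.ctrl = h.choose := dif_pos h
    rw [e]
    exact h.choose_spec
  refine ⟨fun m hm η => ?_, fun m hm η => ?_, fun m hm η => ?_⟩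
  · rcases hm.lt_or_eq with hm | rfl
    · exact hn.mem m (Nat.le_of_lt_succ hm) η
    · exact (key η).1
  · rcases hm.lt_or_eq with hm | rfl
    · exact hn.eq_of m (Nat.le_of_lt_succ hm) η
    · exact (key η).2.2
  · rcases (Nat.le_of_lt_succ hm).lt_or_eq with hm | rfl
    · exact hn.bd_eq m hm η
    · exact (key η).2.1

theorem valid (n : ℕ) : Valid n := by
  induction n with
  | zero => exact valid_zero
  | succ n ih =>
    refine ih.succ fun j hj => ?_
    subst hj
    exact ih.acyclic

end SmallChains

/-! ### The singular chain complex -/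

namespace SmallChains

variable {X : Type u} [TopologicalSpace X]

/-- The singular `n`-chains as a group of augmented chains. -/
noncomputable def toChains (X : Type u) [TopologicalSpace X] (n : ℕ) :
    (singularChains X).X n ≃+ Chains X (n + 1) :=
  FreeAbelianGroup.equivOfEquiv (TopCat.toSSetObjEquiv (TopCat.of X) (op ⦋n⦌))

theorem toChains_of {n : ℕ} (σ : SingularSimplex X n) :
    toChains X n (singularChains.of σ) = FreeAbelianGroup.of σ.toMap :=
  FreeAbelianGroup.map_of_apply σ

theorem exists_toMap_eq {n : ℕ} (σ : C(Spx (n + 1), X)) :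
    ∃ τ : SingularSimplex X n, τ.toMap = σ :=
  (TopCat.toSSetObjEquiv (TopCat.of X) (op ⦋n⦌)).surjective σ

theorem toChains_d (n : ℕ) (x : (singularChains X).X (n + 1)) :
    toChains X n ((singularChains X).d (n + 1) n x) = bd (n + 1) (toChains X (n + 1) x) := by
  obtain ⟨y, rfl⟩ := (toChains X (n + 1)).symm.surjective x
  rw [AddEquiv.apply_symm_apply, ← sub_eq_zero]
  refine map_mem (((toChains X n).toAddMonoidHom.comp ((singularChains X).d (n + 1) n).hom).comp
    (toChains X (n + 1)).symm.toAddMonoidHom - bd (n + 1)) ⊥ (fun σ => ?_) y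
  obtain ⟨τ, rfl⟩ := exists_toMap_eq σ
  rw [AddSubgroup.mem_bot, AddMonoidHom.sub_apply, sub_eq_zero, bd_of]
  have h : (toChains X (n + 1)).symm (FreeAbelianGroup.of τ.toMap) = singularChains.of τ := by
    rw [← toChains_of, AddEquiv.symm_apply_apply]
  change toChains X n ((singularChains X).d (n + 1) n
    ((toChains X (n + 1)).symm (FreeAbelianGroup.of τ.toMap))) = _
  rw [h, singularChains.d_of, map_sum]
  refine Finset.sum_congr rfl fun i _ => ?_
  rw [map_zsmul, toChains_of]
  rfl

theorem toChains_mem (η : Nesting X) {n : ℕ} {x : (singularChains X).X n}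
    (hx : x ∈ η.chainSubgroup n) : toChains X n x ∈ chn η.ctrl (n + 1) := by
  suffices η.chainSubgroup n ≤ (chn η.ctrl (n + 1)).comap (toChains X n).toAddMonoidHom from this hx
  rw [Nesting.chainSubgroup, AddSubgroup.closure_le]
  rintro _ ⟨σ, hσ, rfl⟩
  change toChains X n (singularChains.of σ) ∈ chn η.ctrl (n + 1)
  rw [toChains_of]
  exact of_mem_chn hσ

theorem toChains_symm_mem (η : Nesting X) {n : ℕ} {x : Chains X (n + 1)}
    (hx : x ∈ chn η.ctrl (n + 1)) : (toChains X n).symm x ∈ η.chainSubgroup n := by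
  refine map_mem_of_chn (toChains X n).symm.toAddMonoidHom (η.chainSubgroup n) (fun σ hσ => ?_) hx
  obtain ⟨τ, rfl⟩ := exists_toMap_eq σ
  have h : (toChains X n).symm (FreeAbelianGroup.of τ.toMap) = singularChains.of τ := by
    rw [← toChains_of, AddEquiv.symm_apply_apply]
  change (toChains X n).symm (FreeAbelianGroup.of τ.toMap) ∈ _
  rw [h]
  exact η.of_mem_chainSubgroup hσ

/-- The approximation of singular chains by chains subordinate to `η`. -/
noncomputable def approxHom (η : Nesting X) (n : ℕ) :
    (singularChains X).X n →+ (singularChains X).X n :=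
  (toChains X n).symm.toAddMonoidHom.comp
    ((extend (approx (n + 1)) η.ctrl).comp (toChains X n).toAddMonoidHom)

theorem toChains_approxHom (η : Nesting X) {n : ℕ} (x : (singularChains X).X n) :
    toChains X n (approxHom η n x) = extend (approx (n + 1)) η.ctrl (toChains X n x) :=
  (toChains X n).apply_symm_apply _

theorem approxHom_mem (η : Nesting X) {n : ℕ} (x : (singularChains X).X n) :
    approxHom η n x ∈ η.chainSubgroup n :=
  toChains_symm_mem η ((valid (n + 1)).extend_mem η le_rfl _)

theorem approxHom_eq_self (η : Nesting X) {n : ℕ} {x : (singularChains X).X n}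
    (hx : x ∈ η.chainSubgroup n) : approxHom η n x = x := by
  apply (toChains X n).injective
  rw [toChains_approxHom, (valid (n + 1)).extend_eq_self η le_rfl (toChains_mem η hx)]

theorem d_approxHom (η : Nesting X) (n : ℕ) (x : (singularChains X).X (n + 1)) :
    (singularChains X).d (n + 1) n (approxHom η (n + 1) x) =
      approxHom η n ((singularChains X).d (n + 1) n x) := by
  apply (toChains X n).injective
  rw [toChains_d, toChains_approxHom, toChains_approxHom, toChains_d]
  exact (valid (n + 2)).bd_extend η (Nat.lt_succ_self _) _

/-- The homotopy between the identity and `approxHom`. -/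
noncomputable def homotopyHom (η : Nesting X) (n : ℕ) :
    (singularChains X).X n →+ (singularChains X).X (n + 1) :=
  (toChains X (n + 1)).symm.toAddMonoidHom.comp
    ((extend (homotopy (n + 1)) η.ctrl).comp (toChains X n).toAddMonoidHom)

theorem toChains_homotopyHom (η : Nesting X) {n : ℕ} (x : (singularChains X).X n) :
    toChains X (n + 1) (homotopyHom η n x) = extend (homotopy (n + 1)) η.ctrl (toChains X n x) :=
  (toChains X (n + 1)).apply_symm_apply _

theorem d_homotopyHom_zero (η : Nesting X) (x : (singularChains X).X 0) :
    (singularChains X).d 1 0 (homotopyHom η 0 x) = x - approxHom η 0 x := by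
  apply (toChains X 0).injective
  rw [toChains_d, toChains_homotopyHom, (valid 1).bd_homotopy η one_pos, Valid.homotopy_zero,
    sub_zero, map_sub, toChains_approxHom]

theorem d_homotopyHom_succ (η : Nesting X) (n : ℕ) (x : (singularChains X).X (n + 1)) :
    (singularChains X).d (n + 2) (n + 1) (homotopyHom η (n + 1) x) =
      x - approxHom η (n + 1) x - homotopyHom η n ((singularChains X).d (n + 1) n x) := by
  apply (toChains X (n + 1)).injective
  rw [toChains_d, toChains_homotopyHom, (valid (n + 2)).bd_homotopy η (Nat.lt_succ_self _),
    map_sub, map_sub, toChains_approxHom, toChains_homotopyHom, toChains_d]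

/-- The approximation of singular chains by subordinate chains, as a map of complexes. -/
noncomputable def retraction (η : Nesting X) : singularChains X ⟶ η.chains where
  f n := AddCommGrpCat.ofHom ((approxHom η n).codRestrict (η.chainSubgroup n) (approxHom_mem η))
  comm' i j hij := by
    obtain rfl : j + 1 = i := hij
    ext x
    exact Subtype.ext (d_approxHom η j x)

theorem chainsι_comp_retraction (η : Nesting X) : η.chainsι ≫ retraction η = 𝟙 η.chains := by
  ext n x
  exact Subtype.ext (approxHom_eq_self η x.2)

/-- `homotopyHom` as a morphism of the category of abelian groups. -/
noncomputable def homotopyMor (η : Nesting X) (n : ℕ) :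
    (singularChains X).X n ⟶ (singularChains X).X (n + 1) :=
  AddCommGrpCat.ofHom (homotopyHom η n)

/-- The components of `retractionHomotopy`. -/
noncomputable def homotopyComponent (η : Nesting X) (i j : ℕ) :
    (singularChains X).X i ⟶ (singularChains X).X j :=
  if h : i + 1 = j then homotopyMor η i ≫ eqToHom (by rw [h]) else 0

theorem homotopyComponent_succ (η : Nesting X) (i : ℕ) :
    homotopyComponent η i (i + 1) = homotopyMor η i := by
  rw [homotopyComponent, dif_pos rfl, eqToHom_refl, Category.comp_id]

/-- The homotopy between the identity and the approximation of singular chains. -/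
noncomputable def retractionHomotopy (η : Nesting X) :
    Homotopy (𝟙 (singularChains X)) (retraction η ≫ η.chainsι) where
  hom := homotopyComponent η
  zero i j hij := dif_neg hij
  comm n := by
    rw [Homotopy.prevD_chainComplex, homotopyComponent_succ]
    cases n with
    | zero =>
      rw [Homotopy.dNext_zero_chainComplex, zero_add]
      ext x
      exact sub_eq_iff_eq_add.1 (d_homotopyHom_zero η x).symm
    | succ n =>
      rw [Homotopy.dNext_succ_chainComplex, homotopyComponent_succ]
      ext x
      have h := d_homotopyHom_succ η n x
      rw [eq_sub_iff_add_eq', eq_sub_iff_add_eq] at h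
      exact h.symm

/-- The inclusion of the subordinate chains as a homotopy equivalence. -/
noncomputable def chainsEquiv (η : Nesting X) : HomotopyEquiv η.chains (singularChains X) where
  hom := η.chainsι
  inv := retraction η
  homotopyHomInvId := Homotopy.ofEq (chainsι_comp_retraction η)
  homotopyInvHomId := (retractionHomotopy η).symm

end SmallChains

/-! ### Dualization -/

section Dual

variable {K L : ChainComplex AddCommGrpCat.{u} ℕ} (A : Type v) [AddCommGroup A]

/-- Precomposition with a homomorphism, as a morphism between terms of dual complexes. -/
noncomputable def dualMor {i j : ℕ} (f : K.X j ⟶ L.X i) :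
    (dualComplex L A).X i ⟶ (dualComplex K A).X j :=
  AddCommGrpCat.ofHom (AddMonoidHom.compHom' f.hom)

/-- The dual of a chain homotopy, given by precomposition. -/
noncomputable def dualHomotopy {f g : K ⟶ L} (h : Homotopy f g) :
    Homotopy (dualMap f A) (dualMap g A) where
  hom i j := dualMor A (h.hom j i)
  zero i j hij := by
    rw [h.zero j i hij]
    ext φ
    apply AddMonoidHom.ext
    intro x
    exact map_zero (show L.X i →+ A from φ)
  comm n := by
    have hn := h.comm n
    rw [Homotopy.prevD_chainComplex] at hn
    rw [Homotopy.dNext_cochainComplex]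
    cases n with
    | zero =>
      rw [Homotopy.dNext_zero_chainComplex, zero_add] at hn
      rw [Homotopy.prevD_zero_cochainComplex, add_zero]
      ext φ
      apply AddMonoidHom.ext
      intro x
      have hx := congrArg (show L.X 0 →+ A from φ) (ConcreteCategory.congr_hom hn x)
      exact hx.trans (map_add (show L.X 0 →+ A from φ) _ _)
    | succ n =>
      rw [Homotopy.dNext_succ_chainComplex] at hn
      rw [Homotopy.prevD_succ_cochainComplex]
      ext φ
      apply AddMonoidHom.ext
      intro x
      have hx := congrArg (show L.X (n + 1) →+ A from φ) (ConcreteCategory.congr_hom hn x)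
      refine (hx.trans (map_add (show L.X (n + 1) →+ A from φ) _ _)).trans ?_
      refine congrArg (· + _) ?_
      refine (map_add (show L.X (n + 1) →+ A from φ) _ _).trans ?_
      exact add_comm _ _

/-- The dual of a chain homotopy equivalence. -/
noncomputable def dualEquiv (e : HomotopyEquiv K L) :
    HomotopyEquiv (dualComplex L A) (dualComplex K A) where
  hom := dualMap e.hom A
  inv := dualMap e.inv A
  homotopyHomInvId := dualHomotopy A e.homotopyInvHomId
  homotopyInvHomId := dualHomotopy A e.homotopyHomInvId

end Dual

theorem mainTheorem2 {X : Type u} [TopologicalSpace X] (η : Nesting X) :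
    (∃ e : HomotopyEquiv η.chains (singularChains X), e.hom = η.chainsι) ∧
    ∀ (A : Type v) [AddCommGroup A],
      ∃ e : HomotopyEquiv (dualComplex (singularChains X) A) (dualComplex η.chains A),
        e.hom = dualMap η.chainsι A :=
  ⟨⟨SmallChains.chainsEquiv η, rfl⟩,
    fun A _ => ⟨dualEquiv A (SmallChains.chainsEquiv η), rfl⟩⟩
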